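/- For $E\subseteq\mathbb R^n$ with $E$ and $\mathbb R^n\setminus E$ nonempty let $d_E(x)=\operatorname{dist}(x,E)-\operatorname{dist}(x,\mathbb R^n\setminus E)$ be the signed distance function. A family of sets $E(t)\subset\mathbb R^n$, $t\in[t_1,t_2]$, each nonempty with nonempty complement, is called a $C^{1,1}$ solution of the positive curvature flow $v=\max(\kappa,0)$ on $[t_1,t_2]$ if, with $d(x,t)=d_{E(t)}(x)$, there is a bounded open set $U\subset\mathbb R^n$ such that $\partial E(t)\subset U$ for all $t\in[t_1,t_2]$, $d\in\mathrm{Lip}(U\times[t_1,t_2])$, the distributional space Hessian satisfies $\nabla^2 d\in L^\infty(U\times[t_1,t_2])$, and $$\frac{\partial d}{\partial t}=\max(\Delta d,0)+O(d)\quad\text{a.e. in }U\times[t_1,t_2],$$ that is, $|\partial_t d-\max(\Delta d,0)|\le C|d|$ a.e. in $U\times[t_1,t_2]$ for some constant $C$. Let $E_1(t)$ and $E_2(t)$, $t\in[t_1,t_2]$, be two $C^{1,1}$ solutions of $v=\max(\kappa,0)$. If $E_1(t_1)\subseteq E_2(t_1)$, then $E_1(t)\subseteq E_2(t)$ for all $t\in[t_1,t_2]$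 up to boundary points: for all $t\in[t_1,t_2]$ the interior of $E_1(t)$ is contained in the interior of $E_2(t)$, the closure of $E_1(t)$ is contained in the closure of $E_2(t)$, and $E_1(t)\subseteq E_2(t)$ whenever $E_1(t)$ is open or $E_2(t)$ is closed. In particular, for every set $E\subset\mathbb R^n$ (for instance one whose boundary is compact and of class $C^{1,1}$), there is, up to boundary points, at most one $C^{1,1}$ solution $E(t)$ on $[t_1,t_2]$ with $E(t_1)=E$: any two such solutions have, for every $t\in[t_1,t_2]$, the same interior and the same closure, and they coincide at every time $t$ at which both are open or both are closed. -/

import Mathlib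

open Set MeasureTheory
open scoped ContDiff

/-- The signed distance function `d_E(x) = dist(x, E) - dist(x, ℝⁿ \ E)`, negative inside `E` and
positive outside. It is meaningful when `E` and its complement are both nonempty
(`Metric.infDist x ∅` is the junk value `0`, while `dist(x, ∅) = +∞`). -/
noncomputable def signedDistToSet {X : Type*} [PseudoMetricSpace X] (E : Set X) (x : X) : ℝ :=
  Metric.infDist x E - Metric.infDist x Eᶜ

/-- The partial derivative of `φ(x, t)` in the `i`-th space direction. -/
noncomputable def spaceDeriv {n : ℕ} (i : Fin n) (φ : EuclideanSpace ℝ (Fin n) × ℝ → ℝ)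
    (p : EuclideanSpace ℝ (Fin n) × ℝ) : ℝ :=
  fderiv ℝ φ p (EuclideanSpace.single i 1, 0)

/-- `H` is the weak (distributional) Hessian in the space variables, on the open space-time set `Q`,
of the function `u(x, t)`: for all indices `i, j` and all test functions `φ ∈ C_c^∞(Q)`,
`∫_Q u ∂ᵢ∂ⱼφ dx dt = ∫_Q Hᵢⱼ φ dx dt`. -/
def IsWeakSpaceHessian {n : ℕ} (Q : Set (EuclideanSpace ℝ (Fin n) × ℝ))
    (u : EuclideanSpace ℝ (Fin n) × ℝ → ℝ)
    (H : EuclideanSpace ℝ (Fin n) × ℝ → Matrix (Fin n) (Fin n) ℝ) : Prop :=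
  ∀ i j : Fin n, ∀ φ : EuclideanSpace ℝ (Fin n) × ℝ → ℝ,
    ContDiff ℝ ∞ φ → HasCompactSupport φ → tsupport φ ⊆ Q →
      ∫ p in Q, u p * spaceDeriv i (spaceDeriv j φ) p = ∫ p in Q, H p i j * φ p

/-- The family of sets `E(t)`, `t ∈ [t₁, t₂]`, is a `C^{1,1}` solution of the positive curvature flow
`v = max(κ, 0)` in `ℝⁿ`. Write `d(x, t) = d_{E(t)}(x)`; this is a finite number exactly when `E(t)`
and its complement are nonempty. There is a bounded open set `U` such that `∂E(t) ⊆ U` for all `t`,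
`d ∈ Lip(U × [t₁, t₂])`, the weak space Hessian of `d` is in `L^∞(U × [t₁, t₂])`, and
`∂d/∂t = max(Δd, 0) + O(d)` a.e. in `U × [t₁, t₂]`, that is,
`|∂d/∂t - max(Δd, 0)| ≤ C |d|` a.e. for some constant `C`, where `Δd` is the trace of the weak
Hessian. The conditions that hold almost everywhere are written on the open set `U × (t₁, t₂)`,
which differs from `U × [t₁, t₂]` by a null set. -/
def IsC11PositiveCurvatureFlow {n : ℕ} (t₁ t₂ : ℝ)
    (E : ℝ → Set (EuclideanSpace ℝ (Fin n))) : Prop :=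
  (∀ t ∈ Icc t₁ t₂, (E t).Nonempty ∧ (E t)ᶜ.Nonempty) ∧
  ∃ U : Set (EuclideanSpace ℝ (Fin n)), IsOpen U ∧ Bornology.IsBounded U ∧
    (∀ t ∈ Icc t₁ t₂, frontier (E t) ⊆ U) ∧
    (∃ K : NNReal, LipschitzOnWith K
      (fun p : EuclideanSpace ℝ (Fin n) × ℝ => signedDistToSet (E p.2) p.1)
      (U ×ˢ Icc t₁ t₂)) ∧
    ∃ H : EuclideanSpace ℝ (Fin n) × ℝ → Matrix (Fin n) (Fin n) ℝ,
      IsWeakSpaceHessian (U ×ˢ Ioo t₁ t₂)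
        (fun p : EuclideanSpace ℝ (Fin n) × ℝ => signedDistToSet (E p.2) p.1) H ∧
      (∀ i j : Fin n, MemLp (fun p => H p i j) ⊤ (volume.restrict (U ×ˢ Ioo t₁ t₂))) ∧
      ∃ C : ℝ, ∀ᵐ p ∂(volume.restrict (U ×ˢ Ioo t₁ t₂)),
        ∃ D : ℝ, HasDerivAt (fun s : ℝ => signedDistToSet (E s) p.1) D p.2 ∧
          |D - max (H p).trace 0| ≤ C * |signedDistToSet (E p.2) p.1|

section PseudoMetricSpace

variable {X : Type*} [PseudoMetricSpace X] {E : Set X}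

theorem signedDistToSet_compl (E : Set X) (x : X) : signedDistToSet Eᶜ x = -signedDistToSet E x := by
  simp [signedDistToSet]

theorem signedDistToSet_of_mem {x : X} (hx : x ∈ E) :
    signedDistToSet E x = -Metric.infDist x Eᶜ := by
  simp [signedDistToSet, Metric.infDist_zero_of_mem hx]

theorem signedDistToSet_of_notMem {x : X} (hx : x ∉ E) :
    signedDistToSet E x = Metric.infDist x E := by
  simp [signedDistToSet, Metric.infDist_zero_of_mem (show x ∈ Eᶜ from hx)]

theorem continuous_signedDistToSet (E : Set X) : Continuous (signedDistToSet E) :=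
  (Metric.continuous_infDist_pt E).sub (Metric.continuous_infDist_pt Eᶜ)

theorem signedDistToSet_nonpos_iff (hE : E.Nonempty) {x : X} :
    signedDistToSet E x ≤ 0 ↔ x ∈ closure E := by
  rw [Metric.mem_closure_iff_infDist_zero hE]
  by_cases hx : x ∈ E
  · rw [signedDistToSet_of_mem hx]
    simp [Metric.infDist_nonneg, Metric.infDist_zero_of_mem hx]
  · rw [signedDistToSet_of_notMem hx]
    exact ⟨fun h => le_antisymm h Metric.infDist_nonneg, fun h => h.le⟩

theorem signedDistToSet_neg_iff (hE : Eᶜ.Nonempty) {x : X} :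
    signedDistToSet E x < 0 ↔ x ∈ interior E := by
  have h := signedDistToSet_nonpos_iff hE (x := x)
  rw [signedDistToSet_compl, closure_compl] at h
  rw [← not_iff_not, not_lt]
  simpa using h

theorem mem_frontier_of_signedDistToSet_eq_zero (hE : E.Nonempty) (hE' : Eᶜ.Nonempty) {x : X}
    (hx : signedDistToSet E x = 0) : x ∈ frontier E :=
  ⟨(signedDistToSet_nonpos_iff hE).1 hx.le, fun h => by
    have := (signedDistToSet_neg_iff hE').2 h
    linarith⟩

end PseudoMetricSpace

section SignedDistance

variable {V : Type*} [NormedAddCommGroup V] [NormedSpace ℝ V] {E F : Set V}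

theorem exists_mem_segment_closure_inter_closure_compl {x y : V} (hx : x ∈ E) (hy : y ∉ E) :
    ∃ q ∈ segment ℝ x y, q ∈ closure E ∧ q ∈ closure Eᶜ := by
  have h := isPreconnected_closed_iff.1 (convex_segment (𝕜 := ℝ) x y).isPreconnected
    (closure E) (closure Eᶜ) isClosed_closure isClosed_closure
    (fun z _ => (em (z ∈ E)).imp (fun h => subset_closure h) (fun h => subset_closure h))
    ⟨x, left_mem_segment ℝ x y, subset_closure hx⟩ ⟨y, right_mem_segment ℝ x y, subset_closure hy⟩
  obtain ⟨q, hq, h1, h2⟩ := h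
  exact ⟨q, hq, h1, h2⟩

theorem signedDistToSet_sub_le_of_mem_of_notMem {x y : V} (hx : x ∈ E) (hy : y ∉ E) :
    signedDistToSet E y - signedDistToSet E x ≤ dist y x := by
  obtain ⟨q, hq, h1, h2⟩ := exists_mem_segment_closure_inter_closure_compl hx hy
  rw [signedDistToSet_of_mem hx, signedDistToSet_of_notMem hy, ← Metric.infDist_closure (s := E),
    ← Metric.infDist_closure (s := Eᶜ)]
  have e1 := Metric.infDist_le_dist_of_mem h1 (x := y)
  have e2 := Metric.infDist_le_dist_of_mem h2 (x := x)
  have e3 := dist_add_dist_of_mem_segment hq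
  rw [dist_comm y q] at e1
  rw [dist_comm y x]
  linarith

theorem signedDistToSet_sub_le (E : Set V) (x y : V) :
    signedDistToSet E x - signedDistToSet E y ≤ dist x y := by
  by_cases hx : x ∈ E <;> by_cases hy : y ∈ E
  · rw [signedDistToSet_of_mem hx, signedDistToSet_of_mem hy]
    have := Metric.infDist_le_infDist_add_dist (s := Eᶜ) (x := y) (y := x)
    rw [dist_comm y x] at this
    linarith
  · have := signedDistToSet_sub_le_of_mem_of_notMem (E := Eᶜ) hy (x := y) (y := x) (by simpa)
    rw [signedDistToSet_compl, signedDistToSet_compl] at this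
    have h1 : signedDistToSet E x ≤ 0 := by
      rw [signedDistToSet_of_mem hx]; simpa using Metric.infDist_nonneg
    have h2 : 0 ≤ signedDistToSet E y := by
      rw [signedDistToSet_of_notMem hy]; exact Metric.infDist_nonneg
    linarith [dist_nonneg (x := x) (y := y)]
  · exact signedDistToSet_sub_le_of_mem_of_notMem hy hx
  · rw [signedDistToSet_of_notMem hx, signedDistToSet_of_notMem hy]
    linarith [Metric.infDist_le_infDist_add_dist (s := E) (x := x) (y := y)]

theorem abs_signedDistToSet_sub_le (E : Set V) (x y : V) :
    |signedDistToSet E x - signedDistToSet E y| ≤ dist x y := by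
  rw [abs_le]
  have h1 := signedDistToSet_sub_le E x y
  have h2 := signedDistToSet_sub_le E y x
  rw [dist_comm] at h2
  constructor <;> linarith

theorem exists_signedDistToSet_eq_zero_of_nonneg [ProperSpace V] (hE : E.Nonempty) {x : V}
    (hx : 0 ≤ signedDistToSet E x) :
    ∃ y, signedDistToSet E y = 0 ∧ dist x y = signedDistToSet E x := by
  obtain ⟨y, hy, hxy⟩ := isClosed_closure.exists_infDist_eq_dist hE.closure x
  have hd : signedDistToSet E x = dist x y := by
    rw [← hxy, Metric.infDist_closure]
    by_cases h : x ∈ E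
    · have h0 := Metric.infDist_nonneg (s := Eᶜ) (x := x)
      rw [signedDistToSet_of_mem h] at hx ⊢
      rw [Metric.infDist_zero_of_mem h]
      linarith
    · exact signedDistToSet_of_notMem h
  refine ⟨y, le_antisymm ((signedDistToSet_nonpos_iff hE).2 hy) ?_, hd.symm⟩
  linarith [signedDistToSet_sub_le E x y]

theorem exists_signedDistToSet_eq_zero [ProperSpace V] (hE : E.Nonempty) (hE' : Eᶜ.Nonempty)
    (x : V) : ∃ y, signedDistToSet E y = 0 ∧ dist x y = |signedDistToSet E x| := by
  rcases le_total 0 (signedDistToSet E x) with h | h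
  · rw [abs_of_nonneg h]
    exact exists_signedDistToSet_eq_zero_of_nonneg hE h
  · rw [abs_of_nonpos h]
    obtain ⟨y, hy, hxy⟩ := exists_signedDistToSet_eq_zero_of_nonneg hE' (x := x)
      (by rw [signedDistToSet_compl]; linarith)
    rw [signedDistToSet_compl] at hy hxy
    exact ⟨y, by linarith, hxy⟩

/-- The nonnegative maximum of `d_F - d_E` is approached on `{d_E ≤ 0 ≤ d_F}`, where
`|d_E| + |d_F| = d_F - d_E`. -/
theorem exists_signedDistToSet_nonpos_nonneg [ProperSpace V] (hE : E.Nonempty) (hE' : Eᶜ.Nonempty)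
    (hF : F.Nonempty) (hF' : Fᶜ.Nonempty) {x : V}
    (hx : 0 ≤ signedDistToSet F x - signedDistToSet E x) :
    ∃ y, signedDistToSet F x - signedDistToSet E x ≤ signedDistToSet F y - signedDistToSet E y ∧
      signedDistToSet E y ≤ 0 ∧ 0 ≤ signedDistToSet F y := by
  rcases lt_or_ge 0 (signedDistToSet E x) with h | h
  · obtain ⟨y, hy, hxy⟩ := exists_signedDistToSet_eq_zero hE hE' x
    rw [abs_of_pos h] at hxy
    have := signedDistToSet_sub_le F x y
    exact ⟨y, by linarith, hy.le, by linarith⟩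
  · rcases lt_or_ge (signedDistToSet F x) 0 with h' | h'
    · obtain ⟨y, hy, hxy⟩ := exists_signedDistToSet_eq_zero hF hF' x
      rw [abs_of_neg h'] at hxy
      have := signedDistToSet_sub_le E y x
      rw [dist_comm] at this
      exact ⟨y, by linarith, by linarith, hy.ge⟩
    · exact ⟨x, le_rfl, h, h'⟩

theorem signedDistToSet_pos_of_abs_sub_le [ProperSpace V] (hE : E.Nonempty) (hE' : Eᶜ.Nonempty)
    (hF : F.Nonempty) (hF' : Fᶜ.Nonempty) {U : Set V} (hFU : frontier F ⊆ U) {κ τ : ℝ}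
    (hκ : κ < τ) (hτ : 0 < τ)
    (hU : ∀ x ∈ U, |signedDistToSet E x - signedDistToSet F x| ≤ κ)
    (hτU : ∀ x, |signedDistToSet E x| ≤ τ → x ∈ U) {x : V} (hx : τ < signedDistToSet E x) :
    0 < signedDistToSet F x := by
  by_contra! hneg
  obtain ⟨y, hy, hxy⟩ := exists_signedDistToSet_eq_zero hE hE' x
  have hx0 : 0 < signedDistToSet E x := hτ.trans hx
  rw [abs_of_pos hx0] at hxy
  set D := signedDistToSet E x with hD
  let γ : ℝ → V := AffineMap.lineMap x y
  have hγ : Continuous γ := AffineMap.lineMap_continuous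
  have hlow : ∀ θ ∈ Icc (0 : ℝ) 1, (1 - θ) * D ≤ signedDistToSet E (γ θ) := by
    intro θ hθ
    have h1 := signedDistToSet_sub_le E x (γ θ)
    have h2 : dist x (γ θ) = θ * D := by
      rw [dist_left_lineMap, hxy, Real.norm_of_nonneg hθ.1]
    linarith
  set θ₁ := 1 - τ / D with hθ₁
  have hτD : τ / D < 1 := (div_lt_one hx0).2 hx
  have hτD0 : 0 < τ / D := div_pos hτ hx0
  have h1D : (1 - θ₁) * D = τ := by rw [hθ₁]; field_simp; ring
  have hend : signedDistToSet E (γ θ₁) ≤ τ := by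
    have h1 := signedDistToSet_sub_le E (γ θ₁) y
    have h2 : dist (γ θ₁) y = τ := by
      rw [dist_lineMap_right, hxy, Real.norm_of_nonneg (by linarith), h1D]
    linarith
  have hend' : τ ≤ signedDistToSet E (γ θ₁) := h1D ▸ hlow θ₁ ⟨by linarith, by linarith⟩
  have hFend : 0 ≤ signedDistToSet F (γ θ₁) := by
    have := hU _ (hτU (γ θ₁) (by rw [abs_of_nonneg (by linarith)]; exact hend))
    rw [abs_le] at this
    linarith
  obtain ⟨θ, hθ, hθ0⟩ := intermediate_value_Icc (f := fun θ => signedDistToSet F (γ θ))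
    (show (0 : ℝ) ≤ θ₁ by linarith) ((continuous_signedDistToSet F).comp hγ).continuousOn
    (show (0 : ℝ) ∈ Icc _ _ from ⟨by simpa [γ] using hneg, hFend⟩)
  have hmem := hU _ (hFU (mem_frontier_of_signedDistToSet_eq_zero hF hF' hθ0))
  have := hlow θ ⟨hθ.1, by linarith [hθ.2]⟩
  have h3 : τ ≤ (1 - θ) * D := by
    rw [← h1D]; exact mul_le_mul_of_nonneg_right (by linarith [hθ.2]) hx0.le
  simp only at hθ0
  rw [hθ0, abs_le] at hmem
  linarith

theorem abs_signedDistToSet_sub_le_of_pos [ProperSpace V] (hE : E.Nonempty) (hE' : Eᶜ.Nonempty)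
    (hF : F.Nonempty) (hF' : Fᶜ.Nonempty) {U : Set V} (hEU : frontier E ⊆ U)
    (hFU : frontier F ⊆ U) {κ τ : ℝ} (hκ : κ < τ) (hτ : 0 < τ)
    (hU : ∀ x ∈ U, |signedDistToSet E x - signedDistToSet F x| ≤ κ)
    (hτU : ∀ x, |signedDistToSet E x| ≤ τ → x ∈ U) {x : V} (hx : τ < signedDistToSet E x) :
    |signedDistToSet E x - signedDistToSet F x| ≤ κ := by
  have hpos := signedDistToSet_pos_of_abs_sub_le hE hE' hF hF' hFU hκ hτ hU hτU hx
  obtain ⟨y, hy, hxy⟩ := exists_signedDistToSet_eq_zero hE hE' x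
  obtain ⟨z, hz, hxz⟩ := exists_signedDistToSet_eq_zero hF hF' x
  have hyU := hU _ (hEU (mem_frontier_of_signedDistToSet_eq_zero hE hE' hy))
  have hzU := hU _ (hFU (mem_frontier_of_signedDistToSet_eq_zero hF hF' hz))
  rw [abs_of_pos (hτ.trans hx)] at hxy
  rw [abs_of_pos hpos] at hxz
  have h1 := signedDistToSet_sub_le F x y
  have h2 := signedDistToSet_sub_le E x z
  rw [abs_le] at *
  constructor <;> linarith

/-- Signed distances that are close on a neighbourhood of both frontiers are close everywhere. -/
theorem abs_signedDistToSet_sub_le_of_forall_mem [ProperSpace V] (hE : E.Nonempty)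
    (hE' : Eᶜ.Nonempty) (hF : F.Nonempty) (hF' : Fᶜ.Nonempty) {U : Set V} (hEU : frontier E ⊆ U)
    (hFU : frontier F ⊆ U) {κ τ : ℝ} (hκ : κ < τ) (hτ : 0 < τ)
    (hU : ∀ x ∈ U, |signedDistToSet E x - signedDistToSet F x| ≤ κ)
    (hτU : ∀ x, |signedDistToSet E x| ≤ τ → x ∈ U) (x : V) :
    |signedDistToSet E x - signedDistToSet F x| ≤ κ := by
  rcases le_or_gt |signedDistToSet E x| τ with h | h
  · exact hU x (hτU x h)
  rcases lt_abs.1 h with h | h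
  · exact abs_signedDistToSet_sub_le_of_pos hE hE' hF hF' hEU hFU hκ hτ hU hτU h
  · have hc : ∀ y, |signedDistToSet Eᶜ y - signedDistToSet Fᶜ y|
        = |signedDistToSet E y - signedDistToSet F y| := fun y => by
      rw [signedDistToSet_compl, signedDistToSet_compl, ← abs_neg]; congr 1; ring
    rw [← hc]
    exact abs_signedDistToSet_sub_le_of_pos hE' (by simpa) hF' (by simpa) (by simpa) (by simpa) hκ hτ
      (fun y hy => (hc y).trans_le (hU y hy))
      (fun y hy => hτU y (by rwa [signedDistToSet_compl, abs_neg] at hy))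
      (by rwa [signedDistToSet_compl])

theorem exists_forall_abs_signedDistToSet_le_mem [ProperSpace V] (hE : E.Nonempty)
    (hE' : Eᶜ.Nonempty) {U : Set V} (hU : IsOpen U) (hUb : Bornology.IsBounded U)
    (hEU : frontier E ⊆ U) :
    ∃ τ > 0, ∀ x, |signedDistToSet E x| ≤ τ → x ∈ U := by
  have hc : IsCompact (frontier E) :=
    Metric.isCompact_of_isClosed_isBounded isClosed_frontier (hUb.subset hEU)
  obtain ⟨τ, hτ, h⟩ := hc.exists_cthickening_subset_open hU hEU
  refine ⟨τ, hτ, fun x hx => h ?_⟩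
  obtain ⟨y, hy, hxy⟩ := exists_signedDistToSet_eq_zero hE hE' x
  exact Metric.mem_cthickening_of_dist_le x y τ _
    (mem_frontier_of_signedDistToSet_eq_zero hE hE' hy) (hxy.trans_le hx)

end SignedDistance

section TimeRegularity

variable {V : Type*} [NormedAddCommGroup V] [NormedSpace ℝ V] [ProperSpace V]
  {E : ℝ → Set V} {I : Set ℝ} {U : Set V} {K : NNReal}

theorem exists_forall_abs_signedDistToSet_sub_le
    (hne : ∀ t ∈ I, (E t).Nonempty ∧ (E t)ᶜ.Nonempty) (hU : IsOpen U) (hUb : Bornology.IsBounded U)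
    (hEU : ∀ t ∈ I, frontier (E t) ⊆ U)
    (hK : LipschitzOnWith K (fun p : V × ℝ => signedDistToSet (E p.2) p.1) (U ×ˢ I))
    {s : ℝ} (hs : s ∈ I) {ε : ℝ} (hε : 0 < ε) :
    ∃ δ > 0, ∀ t ∈ I, |t - s| < δ →
      ∀ x, |signedDistToSet (E t) x - signedDistToSet (E s) x| ≤ ε := by
  obtain ⟨τ, hτ, hτU⟩ :=
    exists_forall_abs_signedDistToSet_le_mem (hne s hs).1 (hne s hs).2 hU hUb (hEU s hs)
  have hm : 0 < min τ ε := lt_min hτ hε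
  have hK1 : (0 : ℝ) < K + 1 := by positivity
  refine ⟨min τ ε / (K + 1), by positivity, fun t ht hts x => ?_⟩
  have hκ : (K + 1) * |t - s| < min τ ε := by
    rw [lt_div_iff₀ hK1] at hts
    linarith
  have := abs_signedDistToSet_sub_le_of_forall_mem (hne s hs).1 (hne s hs).2 (hne t ht).1
    (hne t ht).2 (hEU s hs) (hEU t ht) (hκ.trans_le (min_le_left _ _)) hτ (fun y hy => by
      have h := hK.dist_le_mul (y, s) ⟨hy, hs⟩ (y, t) ⟨hy, ht⟩
      rw [Real.dist_eq, Prod.dist_eq, dist_self, max_eq_right dist_nonneg, dist_comm,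
        Real.dist_eq] at h
      simp only at h
      nlinarith [abs_nonneg (t - s)]) hτU x
  rw [abs_sub_comm]
  exact this.trans (hκ.le.trans (min_le_right _ _))

theorem continuousOn_signedDistToSet
    (hne : ∀ t ∈ I, (E t).Nonempty ∧ (E t)ᶜ.Nonempty) (hU : IsOpen U) (hUb : Bornology.IsBounded U)
    (hEU : ∀ t ∈ I, frontier (E t) ⊆ U)
    (hK : LipschitzOnWith K (fun p : V × ℝ => signedDistToSet (E p.2) p.1) (U ×ˢ I)) :
    ContinuousOn (fun p : V × ℝ => signedDistToSet (E p.2) p.1) (univ ×ˢ I) := by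
  rintro ⟨x, s⟩ ⟨-, hs⟩
  rw [Metric.continuousWithinAt_iff]
  intro ε hε
  obtain ⟨δ, hδ, h⟩ := exists_forall_abs_signedDistToSet_sub_le hne hU hUb hEU hK hs (half_pos hε)
  refine ⟨min δ (ε / 2), by positivity, ?_⟩
  rintro ⟨y, t⟩ ⟨-, ht⟩ hd
  rw [Prod.dist_eq, max_lt_iff] at hd
  have h1 := h t ht (hd.2.trans_le (min_le_left _ _)) y
  have h2 := abs_signedDistToSet_sub_le (E s) y x
  have h3 := hd.1.trans_le (min_le_right _ _)
  rw [Real.dist_eq]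
  calc |signedDistToSet (E t) y - signedDistToSet (E s) x|
      ≤ |signedDistToSet (E t) y - signedDistToSet (E s) y|
        + |signedDistToSet (E s) y - signedDistToSet (E s) x| := abs_sub_le _ _ _
    _ < ε := by simp only at h3; linarith

end TimeRegularity

theorem IsLocalMax.deriv_deriv_nonpos {f : ℝ → ℝ} {a : ℝ} (h : IsLocalMax f a)
    (hc : ContinuousAt f a) : deriv (deriv f) a ≤ 0 := by
  by_contra! hpos
  have hmin := isLocalMin_of_deriv_deriv_pos hpos h.deriv_eq_zero hc
  have heq : f =ᶠ[nhds a] fun _ => f a := by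
    filter_upwards [h, hmin] with x h1 h2 using le_antisymm h1 h2
  have h1 : deriv f =ᶠ[nhds a] deriv fun _ => f a := heq.deriv
  have h2 := h1.deriv_eq
  simp at h2
  linarith

theorem hasDerivAt_comp_add_smul {E : Type*} [NormedAddCommGroup E] [NormedSpace ℝ E] {f : E → ℝ}
    (q v : E) (s : ℝ) (hf : DifferentiableAt ℝ f (q + s • v)) :
    HasDerivAt (fun s : ℝ => f (q + s • v)) (fderiv ℝ f (q + s • v) v) s := by
  have h : HasDerivAt (fun s : ℝ => q + s • v) v s := by
    simpa using ((hasDerivAt_id s).smul_const v).const_add q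
  exact hf.hasFDerivAt.comp_hasDerivAt s h

section SpaceTime

variable {n : ℕ}

/-- The time derivative of `φ(x, t)`. -/
noncomputable def timeDeriv (φ : EuclideanSpace ℝ (Fin n) × ℝ → ℝ)
    (p : EuclideanSpace ℝ (Fin n) × ℝ) : ℝ :=
  fderiv ℝ φ p (0, 1)

/-- The gradient of `φ(x, t)` in the space variables. -/
noncomputable def spaceGrad (φ : EuclideanSpace ℝ (Fin n) × ℝ → ℝ)
    (p : EuclideanSpace ℝ (Fin n) × ℝ) : EuclideanSpace ℝ (Fin n) :=
  WithLp.toLp 2 fun i => spaceDeriv i φ p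

/-- The Hessian of `φ(x, t)` in the space variables. -/
noncomputable def spaceHessian (φ : EuclideanSpace ℝ (Fin n) × ℝ → ℝ)
    (p : EuclideanSpace ℝ (Fin n) × ℝ) : Matrix (Fin n) (Fin n) ℝ :=
  Matrix.of fun i j => spaceDeriv i (spaceDeriv j φ) p

theorem ContDiff.spaceDeriv {φ : EuclideanSpace ℝ (Fin n) × ℝ → ℝ} (hφ : ContDiff ℝ ∞ φ)
    (i : Fin n) : ContDiff ℝ ∞ (spaceDeriv i φ) :=
  (hφ.fderiv_right (m := ∞) (by simp)).clm_apply contDiff_const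

theorem ContDiff.timeDeriv {φ : EuclideanSpace ℝ (Fin n) × ℝ → ℝ} (hφ : ContDiff ℝ ∞ φ) :
    ContDiff ℝ ∞ (timeDeriv φ) :=
  (hφ.fderiv_right (m := ∞) (by simp)).clm_apply contDiff_const

theorem HasCompactSupport.spaceDeriv {φ : EuclideanSpace ℝ (Fin n) × ℝ → ℝ}
    (hφ : HasCompactSupport φ) (i : Fin n) : HasCompactSupport (spaceDeriv i φ) :=
  hφ.fderiv_apply ℝ _

theorem ContDiff.spaceGrad {φ : EuclideanSpace ℝ (Fin n) × ℝ → ℝ} (hφ : ContDiff ℝ ∞ φ) :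
    ContDiff ℝ ∞ (spaceGrad φ) := by
  rw [contDiff_euclidean]
  exact fun i => hφ.spaceDeriv i

theorem ContDiff.continuous_trace_spaceHessian {φ : EuclideanSpace ℝ (Fin n) × ℝ → ℝ}
    (hφ : ContDiff ℝ ∞ φ) : Continuous fun p => (spaceHessian φ p).trace :=
  continuous_finsetSum _ fun i _ => ((hφ.spaceDeriv i).spaceDeriv i).continuous

theorem inner_spaceGrad {φ : EuclideanSpace ℝ (Fin n) × ℝ → ℝ} (p : EuclideanSpace ℝ (Fin n) × ℝ)
    (v : EuclideanSpace ℝ (Fin n)) : inner ℝ (spaceGrad φ p) v = fderiv ℝ φ p (v, 0) := by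
  have hv : v = ∑ i, v i • EuclideanSpace.single i (1 : ℝ) := by
    simpa using ((EuclideanSpace.basisFun (Fin n) ℝ).sum_repr v).symm
  have h2 : ((v, 0) : EuclideanSpace ℝ (Fin n) × ℝ)
      = ∑ i, v i • ((EuclideanSpace.single i (1 : ℝ), 0) : EuclideanSpace ℝ (Fin n) × ℝ) := by
    ext1
    · simpa [Prod.fst_sum] using hv
    · simp [Prod.snd_sum]
  rw [h2, map_sum, PiLp.inner_apply]
  refine Finset.sum_congr rfl fun i _ => ?_
  rw [map_smul]
  simp [spaceGrad, spaceDeriv]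

/-- The first time at which the graph of `g` touches a plane from below, the plane being above `g`
on the parabolic boundary of a cylinder. -/
theorem exists_first_touch {g : EuclideanSpace ℝ (Fin n) × ℝ → ℝ} (hg : ContDiff ℝ ∞ g)
    {x₀ p : EuclideanSpace ℝ (Fin n)} {t₀ ρ h : ℝ} (hρ : 0 < ρ) (hh : h ≤ g (x₀, t₀))
    (hbd : ∀ x ∈ Metric.closedBall x₀ ρ, ∀ t ∈ Icc (t₀ - ρ) t₀, (dist x x₀ = ρ ∨ t = t₀ - ρ) →
      g (x, t) - inner ℝ p (x - x₀) < h) :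
    ∃ q ∈ Metric.ball x₀ ρ ×ˢ Ioc (t₀ - ρ) t₀, 0 ≤ timeDeriv g q ∧
      (spaceHessian g q).trace ≤ 0 ∧ spaceGrad g q = p ∧ g q - inner ℝ p (q.1 - x₀) = h := by
  set φ : EuclideanSpace ℝ (Fin n) × ℝ → ℝ := fun q => g q - inner ℝ p (q.1 - x₀) with hφdef
  have hφ : ContDiff ℝ ∞ φ :=
    hg.sub (contDiff_const.inner ℝ (contDiff_fst.sub contDiff_const))
  have hS : IsCompact ((Metric.closedBall x₀ ρ ×ˢ Icc (t₀ - ρ) t₀) ∩ {q | h ≤ φ q}) :=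
    ((isCompact_closedBall x₀ ρ).prod isCompact_Icc).inter_right
      (isClosed_le continuous_const hφ.continuous)
  obtain ⟨⟨x, t⟩, ⟨⟨hx, ht⟩, hxt⟩, hmin⟩ := hS.exists_isMinOn
    ⟨(x₀, t₀), ⟨⟨Metric.mem_closedBall_self hρ.le, by linarith, le_rfl⟩, by simpa [φ] using hh⟩⟩
    continuous_snd.continuousOn
  change dist x x₀ ≤ ρ at hx
  change t ∈ Icc _ _ at ht
  change h ≤ φ (x, t) at hxt
  have hxρ : dist x x₀ < ρ := lt_of_le_of_ne hx fun h' => by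
    have := hbd x hx t ht (Or.inl h'); exact absurd hxt (not_le.2 this)
  have htρ : t₀ - ρ < t := lt_of_le_of_ne ht.1 fun h' => by
    have := hbd x hx t ht (Or.inr h'.symm); exact absurd hxt (not_le.2 this)
  have hlt : ∀ y ∈ Metric.closedBall x₀ ρ, ∀ s ∈ Ico (t₀ - ρ) t, φ (y, s) < h := by
    intro y hy s hs
    by_contra! hc
    have hm : (y, s) ∈ (Metric.closedBall x₀ ρ ×ˢ Icc (t₀ - ρ) t₀) ∩ {q | h ≤ φ q} :=
      ⟨mk_mem_prod hy ⟨hs.1, hs.2.le.trans ht.2⟩, hc⟩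
    have : t ≤ s := isMinOn_iff.1 hmin (y, s) hm
    linarith [hs.2]
  have hle : ∀ y ∈ Metric.closedBall x₀ ρ, φ (y, t) ≤ h := by
    intro y hy
    have hc : Filter.Tendsto (fun s => φ (y, s)) (nhdsWithin t (Iio t)) (nhds (φ (y, t))) :=
      ((hφ.continuous.comp (Continuous.prodMk_right y)).tendsto t).mono_left nhdsWithin_le_nhds
    refine le_of_tendsto hc ?_
    filter_upwards [Ico_mem_nhdsLT htρ] with s hs using (hlt y hy s hs).le
  have heq : φ (x, t) = h := le_antisymm (hle x hx) hxt
  have hφd : Differentiable ℝ φ := hφ.differentiable (by simp)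
  have hgd : Differentiable ℝ g := hg.differentiable (by simp)
  have hderiv : ∀ q (v : EuclideanSpace ℝ (Fin n)) (s : ℝ), fderiv ℝ φ q (v, s) =
      fderiv ℝ g q (v, s) - inner ℝ p v := by
    intro q v s
    have h1 : HasFDerivAt (fun q : EuclideanSpace ℝ (Fin n) × ℝ => inner ℝ p (q.1 - x₀))
        ((innerSL ℝ p).comp (ContinuousLinearMap.fst ℝ _ ℝ)) q :=
      (innerSL ℝ p).hasFDerivAt.comp q (hasFDerivAt_fst.sub_const x₀)
    have h2 : HasFDerivAt φ (fderiv ℝ g q - (innerSL ℝ p).comp (ContinuousLinearMap.fst ℝ _ ℝ)) q :=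
      (hgd q).hasFDerivAt.sub h1
    rw [h2.fderiv]
    simp
  have hmax : ∀ v : EuclideanSpace ℝ (Fin n),
      IsLocalMax (fun s : ℝ => φ ((x, t) + s • (v, (0 : ℝ)))) 0 := by
    intro v
    have hc : Continuous fun s : ℝ => dist (x + s • v) x₀ := by fun_prop
    have := hc.continuousAt.eventually (Iio_mem_nhds (show dist (x + (0 : ℝ) • v) x₀ < ρ by simpa))
    filter_upwards [this] with s hs
    simpa [heq] using hle (x + s • v) hs.le
  have hD : ∀ v : EuclideanSpace ℝ (Fin n), deriv (fun s : ℝ => φ ((x, t) + s • (v, (0 : ℝ))))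
      = fun s => fderiv ℝ φ ((x, t) + s • (v, (0 : ℝ))) (v, 0) := fun v =>
    funext fun s => (hasDerivAt_comp_add_smul _ _ s (hφd _)).deriv
  refine ⟨(x, t), mk_mem_prod hxρ ⟨htρ, ht.2⟩, ?_, ?_, ?_, heq⟩
  · have hd := hasDerivAt_comp_add_smul (f := φ) (x, t) (0, 1) 0 (hφd _)
    simp only [zero_smul, add_zero, hderiv, inner_zero_right, sub_zero] at hd
    refine ge_of_tendsto (hd.tendsto_slope.mono_left (nhdsLT_le_nhdsNE 0)) ?_
    filter_upwards [Ico_mem_nhdsLT (show t₀ - ρ - t < 0 by linarith)] with s hs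
    have := hlt x hx (t + s) ⟨by linarith [hs.1], by linarith [hs.2]⟩
    rw [slope_def_field]
    refine div_nonneg_of_nonpos ?_ (by linarith [hs.2])
    simp [heq, this.le]
  · refine Finset.sum_nonpos fun i _ => ?_
    have h1 := (hmax (EuclideanSpace.single i 1)).deriv_deriv_nonpos
      (hφ.continuous.comp (by fun_prop)).continuousAt
    rw [hD] at h1
    have h2 : (fun s : ℝ => fderiv ℝ φ ((x, t) + s • (EuclideanSpace.single i (1 : ℝ), (0 : ℝ)))
        (EuclideanSpace.single i 1, 0)) = fun s : ℝ =>
        spaceDeriv i g ((x, t) + s • (EuclideanSpace.single i (1 : ℝ), (0 : ℝ))) - p i := by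
      funext s
      rw [hderiv, spaceDeriv]
      simp [EuclideanSpace.inner_single_right]
    rw [h2, ((hasDerivAt_comp_add_smul (x, t) (EuclideanSpace.single i (1 : ℝ), (0 : ℝ)) 0
      ((hg.spaceDeriv i).differentiable (by simp) _)).sub_const _).deriv] at h1
    simpa [spaceHessian, spaceDeriv] using h1
  · ext i
    have h1 := (hmax (EuclideanSpace.single i 1)).deriv_eq_zero
    simp only [hD, hderiv] at h1
    simp [EuclideanSpace.inner_single_right] at h1
    simp [spaceGrad, spaceDeriv]
    linarith

end SpaceTime

theorem LinearMap.det_of_prod_upper {V ι : Type*} [AddCommGroup V] [Module ℝ V] [Fintype ι]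
    [DecidableEq ι] (b : Module.Basis ι ℝ V) (f : V × ℝ →ₗ[ℝ] V × ℝ) (A : V →ₗ[ℝ] V)
    (h : ∀ v, f (v, 0) = (A v, 0)) :
    LinearMap.det f = (LinearMap.toMatrix b b A).det * (f (0, 1)).2 := by
  let B := b.prod (Module.Basis.singleton Unit ℝ)
  have hM : LinearMap.toMatrix B B f = Matrix.fromBlocks (LinearMap.toMatrix b b A)
      (Matrix.of fun i _ => b.repr (f (0, 1)).1 i) 0 (Matrix.of fun _ _ => (f (0, 1)).2) := by
    ext i j
    rcases i with i | i <;> rcases j with j | j <;>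
      simp [B, LinearMap.toMatrix_apply, h]
  rw [← LinearMap.det_toMatrix B, hM, Matrix.det_fromBlocks_zero₂₁]
  simp

theorem LinearMap.det_of_prod_lower {V ι : Type*} [AddCommGroup V] [Module ℝ V] [Fintype ι]
    [DecidableEq ι] (b : Module.Basis ι ℝ V) (f : V × ℝ →ₗ[ℝ] V × ℝ)
    (h : ∀ v, (f (v, 0)).1 = v) (h1 : f (0, 1) = (0, 1)) :
    LinearMap.det f = 1 := by
  let B := b.prod (Module.Basis.singleton Unit ℝ)
  have hM : LinearMap.toMatrix B B f = Matrix.fromBlocks 1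
      0 (Matrix.of fun _ j => (f (b j, 0)).2) 1 := by
    ext i j
    rcases i with i | i <;> rcases j with j | j <;>
      simp [B, LinearMap.toMatrix_apply, h, h1, Matrix.one_apply, Finsupp.single_apply, eq_comm]
  rw [← LinearMap.det_toMatrix B, hM, Matrix.det_fromBlocks_zero₁₂]
  simp

section SpaceTime

variable {n : ℕ}

instance : (volume : Measure (EuclideanSpace ℝ (Fin n) × ℝ)).IsAddHaarMeasure :=
  inferInstanceAs ((volume : Measure (EuclideanSpace ℝ (Fin n))).prod
    (volume : Measure ℝ)).IsAddHaarMeasure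

/-- The map sending a point `(x, t)` to the tangent plane of `g(·, t)` at `x`: its slope and its
height over `x₀`. -/
noncomputable def tangentPlaneMap (g : EuclideanSpace ℝ (Fin n) × ℝ → ℝ)
    (x₀ : EuclideanSpace ℝ (Fin n)) (q : EuclideanSpace ℝ (Fin n) × ℝ) :
    EuclideanSpace ℝ (Fin n) × ℝ :=
  (spaceGrad g q, g q - inner ℝ (spaceGrad g q) (q.1 - x₀))

theorem exists_hasFDerivAt_tangentPlaneMap {g : EuclideanSpace ℝ (Fin n) × ℝ → ℝ}
    (hg : ContDiff ℝ ∞ g) (x₀ : EuclideanSpace ℝ (Fin n)) (q : EuclideanSpace ℝ (Fin n) × ℝ) :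
    ∃ T : EuclideanSpace ℝ (Fin n) × ℝ →L[ℝ] EuclideanSpace ℝ (Fin n) × ℝ,
      HasFDerivAt (tangentPlaneMap g x₀) T q ∧
        T.det = (spaceHessian g q).det * timeDeriv g q := by
  have hG := (hg.spaceGrad.differentiable (by simp) q).hasFDerivAt
  have hgq := (hg.differentiable (by simp) q).hasFDerivAt
  set A := fderiv ℝ (spaceGrad g) q with hA
  have hx : HasFDerivAt (fun q : EuclideanSpace ℝ (Fin n) × ℝ => q.1 - x₀)
      (ContinuousLinearMap.fst ℝ (EuclideanSpace ℝ (Fin n)) ℝ) q := hasFDerivAt_fst.sub_const x₀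
  refine ⟨_, hG.prodMk (hgq.sub (hG.inner ℝ hx)), ?_⟩
  set T := A.prod (fderiv ℝ g q - (fderivInnerCLM ℝ (spaceGrad g q, q.1 - x₀)).comp
    (A.prod (ContinuousLinearMap.fst ℝ (EuclideanSpace ℝ (Fin n)) ℝ))) with hT
  let S : EuclideanSpace ℝ (Fin n) × ℝ →L[ℝ] EuclideanSpace ℝ (Fin n) × ℝ :=
    (ContinuousLinearMap.fst ℝ _ ℝ).prod (ContinuousLinearMap.snd ℝ _ ℝ +
      (innerSL ℝ (q.1 - x₀)).comp (ContinuousLinearMap.fst ℝ _ ℝ))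
  let b := (EuclideanSpace.basisFun (Fin n) ℝ).toBasis
  have hS : LinearMap.det (S : EuclideanSpace ℝ (Fin n) × ℝ →ₗ[ℝ] EuclideanSpace ℝ (Fin n) × ℝ) = 1 :=
    LinearMap.det_of_prod_lower b _ (fun v => by simp [S]) (by simp [S])
  have hST : ∀ v s, S (T (v, s)) = (A (v, s), fderiv ℝ g q (0, s)) := by
    intro v s
    have e : fderiv ℝ g q (v, s) = fderiv ℝ g q (v, 0) + fderiv ℝ g q (0, s) := by
      rw [← map_add]; simp
    simp [S, T, e, ← inner_spaceGrad, real_inner_comm, inner_sub_left]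
  have hdet := LinearMap.det_of_prod_upper b
    ((S.comp T : EuclideanSpace ℝ (Fin n) × ℝ →L[ℝ] EuclideanSpace ℝ (Fin n) × ℝ) :
      EuclideanSpace ℝ (Fin n) × ℝ →ₗ[ℝ] EuclideanSpace ℝ (Fin n) × ℝ)
    ((A.comp (ContinuousLinearMap.inl ℝ _ ℝ)).toLinearMap) (fun v => by
      have h0 := hST v 0
      have e : fderiv ℝ g q (0, 0) = 0 := map_zero (fderiv ℝ g q)
      rw [e] at h0
      simpa using h0)
  have hmul : LinearMap.det ((S.comp T : EuclideanSpace ℝ (Fin n) × ℝ →L[ℝ]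
      EuclideanSpace ℝ (Fin n) × ℝ) : EuclideanSpace ℝ (Fin n) × ℝ →ₗ[ℝ]
      EuclideanSpace ℝ (Fin n) × ℝ) = T.det := by
    rw [ContinuousLinearMap.toLinearMap_comp, LinearMap.det_comp, hS, one_mul]
  rw [← hmul, hdet]
  congr 1
  · rw [← Matrix.det_transpose]
    congr 1
    ext i j
    have hcoord : HasFDerivAt (spaceDeriv j g) ((EuclideanSpace.proj j : _ →L[ℝ] ℝ).comp A) q :=
      (EuclideanSpace.proj (𝕜 := ℝ) j).hasFDerivAt.comp q hG
    simp only [Matrix.transpose_apply, LinearMap.toMatrix_apply, spaceHessian, Matrix.of_apply]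
    rw [spaceDeriv, hcoord.fderiv]
    simp [b]
  · have := hST 0 1
    simp [this, timeDeriv]

theorem volume_le_of_subset_image_tangentPlaneMap {g : EuclideanSpace ℝ (Fin n) × ℝ → ℝ}
    (hg : ContDiff ℝ ∞ g) (x₀ : EuclideanSpace ℝ (Fin n))
    {Γ B : Set (EuclideanSpace ℝ (Fin n) × ℝ)} (hΓ : MeasurableSet Γ) {Λ K : ℝ}
    (hΛ : ∀ q ∈ Γ, ∀ i j, |spaceHessian g q i j| ≤ Λ) (hK : ∀ q ∈ Γ, |timeDeriv g q| ≤ K)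
    (hB : B ⊆ tangentPlaneMap g x₀ '' Γ) :
    volume B ≤ ENNReal.ofReal (n.factorial * Λ ^ n * K) * volume Γ := by
  choose T hT hdet using exists_hasFDerivAt_tangentPlaneMap hg x₀
  calc volume B ≤ volume (tangentPlaneMap g x₀ '' Γ) := measure_mono hB
    _ ≤ ∫⁻ q in Γ, ENNReal.ofReal |(T q).det| :=
      addHaar_image_le_lintegral_abs_det_fderiv volume hΓ fun q _ => (hT q).hasFDerivWithinAt
    _ ≤ ∫⁻ q in Γ, ENNReal.ofReal (n.factorial * Λ ^ n * K) := by
      refine setLIntegral_mono measurable_const fun q hq => ENNReal.ofReal_le_ofReal ?_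
      rw [hdet, abs_mul]
      have h1 := Matrix.det_le (abv := IsAbsoluteValue.toAbsoluteValue abs) (hΛ q hq)
      simp only [Fintype.card_fin, nsmul_eq_mul] at h1
      exact mul_le_mul h1 (hK q hq) (abs_nonneg _) ((abs_nonneg _).trans h1)
    _ = _ := by simp

/-- A lower bound for the measure of the set where `g` is both nondecreasing in time and
superharmonic in space, for a function `g` whose value at the top centre of a cylinder exceeds its
values on the parabolic boundary by `θ`. -/
theorem volume_prod_le_of_parabolic_boundary {g : EuclideanSpace ℝ (Fin n) × ℝ → ℝ}
    (hg : ContDiff ℝ ∞ g) {x₀ : EuclideanSpace ℝ (Fin n)} {t₀ ρ θ m Λ K : ℝ} (hρ : 0 < ρ)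
    (hm : m ≤ g (x₀, t₀))
    (hbd : ∀ x ∈ Metric.closedBall x₀ ρ, ∀ t ∈ Icc (t₀ - ρ) t₀, (dist x x₀ = ρ ∨ t = t₀ - ρ) →
      g (x, t) ≤ m - θ)
    (hΛ : ∀ q ∈ Metric.ball x₀ ρ ×ˢ Ioc (t₀ - ρ) t₀, ∀ i j, |spaceHessian g q i j| ≤ Λ)
    (hK : ∀ q ∈ Metric.ball x₀ ρ ×ˢ Ioc (t₀ - ρ) t₀, |timeDeriv g q| ≤ K) :
    volume (Metric.ball (0 : EuclideanSpace ℝ (Fin n)) (θ / (2 * ρ)) ×ˢ Ioo (m - θ / 2) m) ≤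
      ENNReal.ofReal (n.factorial * Λ ^ n * K) *
        volume {q ∈ Metric.ball x₀ ρ ×ˢ Ioc (t₀ - ρ) t₀ |
          0 ≤ timeDeriv g q ∧ (spaceHessian g q).trace ≤ 0} := by
  refine volume_le_of_subset_image_tangentPlaneMap hg x₀ ?_ (fun q hq => hΛ q hq.1)
    (fun q hq => hK q hq.1) ?_
  · exact (measurableSet_ball.prod measurableSet_Ioc).inter
      ((measurableSet_le measurable_const hg.timeDeriv.continuous.measurable).inter
        (measurableSet_le hg.continuous_trace_spaceHessian.measurable measurable_const))
  · rintro ⟨p, h⟩ ⟨hp, hh⟩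
    simp only [mem_ball_zero_iff] at hp
    obtain ⟨q, hq, h1, h2, h3, h4⟩ := exists_first_touch hg (p := p) (h := h) hρ
      (hh.2.le.trans hm) (fun x hx t ht hxt => by
        have h1 := hbd x hx t ht hxt
        have h2 : |inner ℝ p (x - x₀)| ≤ ‖p‖ * ρ :=
          (abs_real_inner_le_norm p (x - x₀)).trans
            (mul_le_mul_of_nonneg_left (by rwa [← dist_eq_norm]) (norm_nonneg p))
        have h3 : ‖p‖ * ρ < θ / 2 := by
          rw [lt_div_iff₀ (by positivity)] at hp
          linarith
        have h4 := (abs_le.1 h2).1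
        have h5 : m - θ / 2 < h := hh.1
        linarith)
    refine ⟨q, ⟨hq, h1, h2⟩, ?_⟩
    rw [tangentPlaneMap, h3, h4]

end SpaceTime

theorem MeasureTheory.MemLp.exists_ae_abs_le {α : Type*} [MeasurableSpace α] {μ : Measure α}
    {f : α → ℝ} (hf : MemLp f ⊤ μ) : ∃ c : ℝ, ∀ᵐ x ∂μ, |f x| ≤ c := by
  refine ⟨(eLpNorm f ⊤ μ).toReal, ?_⟩
  filter_upwards [ae_le_eLpNormEssSup (f := f) (μ := μ)] with x hx
  rw [← eLpNorm_exponent_top] at hx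
  have := ENNReal.toReal_mono hf.eLpNorm_ne_top hx
  simpa using this

section Mollification

open ContinuousLinearMap
open scoped Convolution Topology

variable {G : Type*} [NormedAddCommGroup G] [NormedSpace ℝ G]

theorem fderiv_comp_const_sub_apply {φ : G → ℝ} (hφ : Differentiable ℝ φ) (p q v : G) :
    fderiv ℝ (fun q => φ (p - q)) q v = -fderiv ℝ φ (p - q) v := by
  have h : HasFDerivAt (fun q : G => p - q) (-ContinuousLinearMap.id ℝ G) q :=
    (hasFDerivAt_id q).const_sub p
  have h2 : HasFDerivAt (fun q => φ (p - q)) _ q := (hφ (p - q)).hasFDerivAt.comp q h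
  rw [h2.fderiv]
  simp

variable [FiniteDimensional ℝ G] [MeasurableSpace G] [BorelSpace G]
  {μ : Measure G} [μ.IsAddHaarMeasure]

theorem fderiv_convolution_apply {φ u : G → ℝ} (hc : HasCompactSupport φ) (hφ : ContDiff ℝ ∞ φ)
    (hu : LocallyIntegrable u μ) (p v : G) :
    fderiv ℝ (φ ⋆[lsmul ℝ ℝ, μ] u) p v =
      ((fun q => fderiv ℝ φ q v) ⋆[lsmul ℝ ℝ, μ] u) p := by
  have h1 : ContDiff ℝ 1 φ := hφ.of_le (by simp)
  rw [← convolution_flip (f := φ), ← convolution_flip (g := u) (f := fun q => fderiv ℝ φ q v),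
    (hc.hasFDerivAt_convolution_right (lsmul ℝ ℝ).flip hu h1 p).fderiv,
    convolution_precompR_apply _ hu (hc.fderiv ℝ) (h1.continuous_fderiv (by simp))]

theorem convolution_lsmul_eq_integral (φ u : G → ℝ) (p : G) :
    (φ ⋆[lsmul ℝ ℝ, μ] u) p = ∫ q, u q * φ (p - q) ∂μ := by
  rw [convolution_eq_swap]
  simp [mul_comm]

theorem ContDiffBump.abs_convolution_normed_le (φ : ContDiffBump (0 : G)) {u : G → ℝ} {Λ : ℝ}
    (hu : ∀ᵐ q ∂μ, |u q| ≤ Λ) (p : G) : |(φ.normed μ ⋆[lsmul ℝ ℝ, μ] u) p| ≤ Λ := by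
  have hint : Integrable (fun q => Λ * φ.normed μ (p - q)) μ :=
    (φ.integrable_normed.comp_sub_left p).const_mul Λ
  rw [convolution_lsmul_eq_integral, ← Real.norm_eq_abs]
  refine (norm_integral_le_of_norm_le hint ?_).trans_eq ?_
  · filter_upwards [hu] with q hq
    rw [norm_mul, Real.norm_of_nonneg (φ.nonneg_normed _)]
    exact mul_le_mul_of_nonneg_right hq (φ.nonneg_normed _)
  · rw [integral_const_mul, integral_sub_left_eq_self (φ.normed μ) μ p, φ.integral_normed, mul_one]

theorem LipschitzWith.fderiv_convolution_normed_apply {K : NNReal} {u : G → ℝ}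
    (hu : LipschitzWith K u) (φ : ContDiffBump (0 : G)) (p v : G) :
    fderiv ℝ (φ.normed μ ⋆[lsmul ℝ ℝ, μ] u) p v =
      (φ.normed μ ⋆[lsmul ℝ ℝ, μ] fun q => lineDeriv ℝ u q v) p := by
  have hφ : ContDiff ℝ ∞ (φ.normed μ) := φ.contDiff_normed
  have hc := φ.hasCompactSupport_normed (μ := μ)
  have hψ : ContDiff ℝ ∞ fun q => φ.normed μ (p - q) := hφ.comp (contDiff_const.sub contDiff_id)
  have hψc : HasCompactSupport fun q => φ.normed μ (p - q) :=
    hc.comp_homeomorph (Homeomorph.subLeft p)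
  obtain ⟨D, hD⟩ := ContDiff.lipschitzWith_of_hasCompactSupport hψc hψ (by simp)
  rw [fderiv_convolution_apply hc hφ hu.continuous.locallyIntegrable,
    convolution_lsmul_eq_integral, convolution_lsmul_eq_integral,
    hu.integral_lineDeriv_mul_eq hD hψc v]
  refine integral_congr_ae (Filter.Eventually.of_forall fun q => ?_)
  simp only
  rw [((hψ.differentiable (by simp)) q).lineDeriv_eq_fderiv,
    fderiv_comp_const_sub_apply (hφ.differentiable (by simp)), map_neg, neg_neg, mul_comm]

end Mollification

section SpaceTime

open ContinuousLinearMap Filter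
open scoped Convolution Topology

variable {n : ℕ}

theorem spaceHessian_convolution_normed {u : EuclideanSpace ℝ (Fin n) × ℝ → ℝ}
    {H : EuclideanSpace ℝ (Fin n) × ℝ → Matrix (Fin n) (Fin n) ℝ}
    {Q : Set (EuclideanSpace ℝ (Fin n) × ℝ)} (hQ : MeasurableSet Q) (hu : Continuous u)
    (hH : IsWeakSpaceHessian Q u H) (φ : ContDiffBump (0 : EuclideanSpace ℝ (Fin n) × ℝ))
    {p : EuclideanSpace ℝ (Fin n) × ℝ} (hp : Metric.closedBall p φ.rOut ⊆ Q) (i j : Fin n) :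
    spaceHessian (φ.normed volume ⋆[lsmul ℝ ℝ, volume] u) p i j =
      (φ.normed volume ⋆[lsmul ℝ ℝ, volume] Q.indicator fun q => H q i j) p := by
  have hφ : ContDiff ℝ ∞ (φ.normed volume) := φ.contDiff_normed
  have hc := φ.hasCompactSupport_normed (μ := volume)
  set ψ : EuclideanSpace ℝ (Fin n) × ℝ → ℝ := fun q => φ.normed volume (p - q)
  have hψ : ContDiff ℝ ∞ ψ := hφ.comp (contDiff_const.sub contDiff_id)
  have hψc : HasCompactSupport ψ := hc.comp_homeomorph (Homeomorph.subLeft p)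
  have hψs : tsupport ψ ⊆ Q := by
    refine (closure_minimal ?_ Metric.isClosed_closedBall).trans hp
    intro q hq
    have : p - q ∈ Function.support (φ.normed volume) := hq
    rw [φ.support_normed_eq, mem_ball_zero_iff, ← dist_eq_norm, dist_comm] at this
    exact this.le
  have h1 : ∀ j, spaceDeriv j (φ.normed volume ⋆[lsmul ℝ ℝ, volume] u) =
      (spaceDeriv j (φ.normed volume)) ⋆[lsmul ℝ ℝ, volume] u := fun j => funext fun q =>
    fderiv_convolution_apply hc hφ hu.locallyIntegrable q _
  have h2 : spaceDeriv i (spaceDeriv j (φ.normed volume ⋆[lsmul ℝ ℝ, volume] u)) p =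
      ((spaceDeriv i (spaceDeriv j (φ.normed volume))) ⋆[lsmul ℝ ℝ, volume] u) p := by
    rw [h1]
    exact fderiv_convolution_apply (hc.spaceDeriv j) (hφ.spaceDeriv j) hu.locallyIntegrable p _
  have h3 : spaceDeriv j ψ = fun q => -spaceDeriv j (φ.normed volume) (p - q) := funext fun q =>
    fderiv_comp_const_sub_apply (hφ.differentiable (by simp)) p q _
  have h4 : spaceDeriv i (spaceDeriv j ψ) =
      fun q => spaceDeriv i (spaceDeriv j (φ.normed volume)) (p - q) := by
    funext q
    rw [h3, spaceDeriv, fderiv_fun_neg, neg_apply,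
      fderiv_comp_const_sub_apply ((hφ.spaceDeriv j).differentiable (by simp)), neg_neg]
    rfl
  have hzero : ∀ f : EuclideanSpace ℝ (Fin n) × ℝ → ℝ, tsupport f ⊆ Q → ∀ q, q ∉ Q → f q = 0 :=
    fun f hf q hq => image_eq_zero_of_notMem_tsupport fun h => hq (hf h)
  have hts : tsupport (spaceDeriv i (spaceDeriv j ψ)) ⊆ Q :=
    ((tsupport_fderiv_apply_subset ℝ _).trans (tsupport_fderiv_apply_subset ℝ _)).trans hψs
  rw [spaceHessian, Matrix.of_apply, h2, convolution_lsmul_eq_integral,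
    convolution_lsmul_eq_integral]
  calc ∫ q, u q * spaceDeriv i (spaceDeriv j (φ.normed volume)) (p - q)
      = ∫ q, u q * spaceDeriv i (spaceDeriv j ψ) q := by rw [h4]
    _ = ∫ q in Q, u q * spaceDeriv i (spaceDeriv j ψ) q :=
      (setIntegral_eq_integral_of_forall_compl_eq_zero fun q hq => by
        rw [hzero _ hts q hq, mul_zero]).symm
    _ = ∫ q in Q, H q i j * ψ q := hH i j ψ hψ hψc hψs
    _ = ∫ q, Q.indicator (fun q => H q i j * ψ q) q := (integral_indicator hQ).symm
    _ = _ := by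
      refine integral_congr_ae (Eventually.of_forall fun q => ?_)
      by_cases hq : q ∈ Q <;> simp [hq, ψ]

theorem exists_mollification {u : EuclideanSpace ℝ (Fin n) × ℝ → ℝ} {K : NNReal}
    (hu : LipschitzWith K u) {Q : Set (EuclideanSpace ℝ (Fin n) × ℝ)} (hQ : IsOpen Q)
    {H : EuclideanSpace ℝ (Fin n) × ℝ → Matrix (Fin n) (Fin n) ℝ}
    (hH : IsWeakSpaceHessian Q u H)
    (hb : ∀ i j : Fin n, MemLp (fun p => H p i j) ⊤ (volume.restrict Q)) :
    ∃ (Λ : ℝ) (g : ℕ → EuclideanSpace ℝ (Fin n) × ℝ → ℝ),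
      (∀ k, ContDiff ℝ ∞ (g k)) ∧ (∀ (k : ℕ) p, |g k p - u p| ≤ K * (1 / ((k : ℝ) + 1))) ∧
      (∀ k p, |timeDeriv (g k) p| ≤ K) ∧
      (∀ (k : ℕ) p, Metric.closedBall p (1 / ((k : ℝ) + 1)) ⊆ Q →
        ∀ i j, |spaceHessian (g k) p i j| ≤ Λ) ∧
      (∀ᵐ p ∂volume, Tendsto (fun k => timeDeriv (g k) p) atTop (𝓝 (lineDeriv ℝ u p (0, 1)))) ∧
      ∀ᵐ p ∂volume.restrict Q,
        Tendsto (fun k => (spaceHessian (g k) p).trace) atTop (𝓝 (H p).trace) := by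
  choose c hcH using fun i j => (hb i j).exists_ae_abs_le
  let φ : ℕ → ContDiffBump (0 : EuclideanSpace ℝ (Fin n) × ℝ) := fun k : ℕ =>
    ⟨1 / ((k : ℝ) + 1) / 2, 1 / ((k : ℝ) + 1), by positivity, half_lt_self (by positivity)⟩
  have hφ0 : Tendsto (fun k => (φ k).rOut) atTop (𝓝 0) := tendsto_one_div_add_atTop_nhds_zero_nat
  have hφ2 : ∀ᶠ k in atTop, (φ k).rOut ≤ 2 * (φ k).rIn :=
    Eventually.of_forall fun k => by simp only [φ]; linarith
  have hli : ∀ i j, LocallyIntegrable (Q.indicator fun q => H q i j) volume := fun i j =>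
    ((memLp_indicator_iff_restrict hQ.measurableSet).2 (hb i j)).locallyIntegrable le_top
  have htime : ∀ k p, timeDeriv ((φ k).normed volume ⋆[lsmul ℝ ℝ, volume] u) p =
      ((φ k).normed volume ⋆[lsmul ℝ ℝ, volume] fun q => lineDeriv ℝ u q (0, 1)) p :=
    fun k p => hu.fderiv_convolution_normed_apply (φ k) p _
  refine ⟨∑ i, ∑ j, |c i j|, fun k => (φ k).normed volume ⋆[lsmul ℝ ℝ, volume] u, fun k =>
    (φ k).hasCompactSupport_normed.contDiff_convolution_left _ (φ k).contDiff_normed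
      hu.continuous.locallyIntegrable, fun k p => ?_, fun k p => ?_, fun k p hp i j => ?_, ?_, ?_⟩
  · rw [← Real.dist_eq]
    refine (φ k).dist_normed_convolution_le hu.continuous.aestronglyMeasurable fun x hx => ?_
    exact (hu.dist_le_mul x p).trans (mul_le_mul_of_nonneg_left (le_of_lt hx) K.2)
  · rw [htime]
    refine (φ k).abs_convolution_normed_le (Eventually.of_forall fun q => ?_) p
    have := norm_lineDeriv_le_of_lipschitz ℝ (x₀ := q)
      (v := ((0, 1) : EuclideanSpace ℝ (Fin n) × ℝ)) hu
    simpa [Prod.norm_def] using this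
  · rw [spaceHessian_convolution_normed hQ.measurableSet hu.continuous hH (φ k) hp]
    refine (φ k).abs_convolution_normed_le ?_ p
    have h0 : |c i j| ≤ ∑ i, ∑ j, |c i j| :=
      (Finset.single_le_sum (f := fun j => |c i j|) (fun _ _ => abs_nonneg _)
        (Finset.mem_univ j)).trans (Finset.single_le_sum (f := fun i => ∑ j, |c i j|)
          (fun _ _ => Finset.sum_nonneg fun _ _ => abs_nonneg _) (Finset.mem_univ i))
    filter_upwards [(ae_restrict_iff' hQ.measurableSet).1 (hcH i j)] with q hq
    by_cases h : q ∈ Q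
    · rw [indicator_of_mem h]
      exact (hq h).trans ((le_abs_self _).trans h0)
    · rw [indicator_of_notMem h, abs_zero]
      exact (abs_nonneg _).trans h0
  · filter_upwards [ContDiffBump.ae_convolution_tendsto_right_of_locallyIntegrable hφ0 hφ2
      (hu.locallyIntegrable_lineDeriv (μ := volume) (0, 1))] with p hp
    simpa only [htime] using hp
  · have hall : ∀ᵐ p ∂volume.restrict Q, ∀ i, Tendsto (fun k =>
        ((φ k).normed volume ⋆[lsmul ℝ ℝ, volume] Q.indicator fun q => H q i i) p) atTop
        (𝓝 (Q.indicator (fun q => H q i i) p)) := ae_all_iff.2 fun i => ae_restrict_of_ae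
      (ContDiffBump.ae_convolution_tendsto_right_of_locallyIntegrable hφ0 hφ2 (hli i i))
    filter_upwards [hall, ae_restrict_mem hQ.measurableSet] with p hp hpQ
    refine tendsto_finsetSum _ fun i _ => ?_
    have h1 := hp i
    rw [indicator_of_mem hpQ] at h1
    refine h1.congr' ?_
    obtain ⟨ε, hε, hεQ⟩ := Metric.isOpen_iff.1 hQ p hpQ
    filter_upwards [hφ0.eventually (Iio_mem_nhds hε)] with k hk
    exact (spaceHessian_convolution_normed hQ.measurableSet hu.continuous hH (φ k)
      ((Metric.closedBall_subset_ball hk).trans hεQ) i i).symm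

end SpaceTime

section SpaceTime

open Filter
open scoped Topology

variable {n : ℕ}

theorem hasFDerivAt_mul_norm_sq (c l t₀ : ℝ) (x₀ : EuclideanSpace ℝ (Fin n))
    (q : EuclideanSpace ℝ (Fin n) × ℝ) :
    HasFDerivAt (fun q : EuclideanSpace ℝ (Fin n) × ℝ => c * (q.2 - t₀) + l * ‖q.1 - x₀‖ ^ 2)
      (c • ContinuousLinearMap.snd ℝ (EuclideanSpace ℝ (Fin n)) ℝ + l • ((2 : ℕ) •
        (innerSL ℝ (q.1 - x₀)).comp (ContinuousLinearMap.fst ℝ (EuclideanSpace ℝ (Fin n)) ℝ))) q :=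
  ((hasFDerivAt_snd.sub_const t₀).const_mul c).add
    ((hasFDerivAt_fst.sub_const x₀).norm_sq.const_mul l)

theorem contDiff_sub_mul_norm_sq {g : EuclideanSpace ℝ (Fin n) × ℝ → ℝ} (hg : ContDiff ℝ ∞ g)
    (c l t₀ : ℝ) (x₀ : EuclideanSpace ℝ (Fin n)) :
    ContDiff ℝ ∞ fun q => g q - (c * (q.2 - t₀) + l * ‖q.1 - x₀‖ ^ 2) :=
  hg.sub ((contDiff_const.mul (contDiff_snd.sub contDiff_const)).add
    (contDiff_const.mul ((contDiff_fst.sub contDiff_const).norm_sq ℝ)))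

theorem timeDeriv_sub_mul_norm_sq {g : EuclideanSpace ℝ (Fin n) × ℝ → ℝ} (hg : ContDiff ℝ ∞ g)
    (c l t₀ : ℝ) (x₀ : EuclideanSpace ℝ (Fin n)) (q : EuclideanSpace ℝ (Fin n) × ℝ) :
    timeDeriv (fun q => g q - (c * (q.2 - t₀) + l * ‖q.1 - x₀‖ ^ 2)) q = timeDeriv g q - c := by
  have h : HasFDerivAt (fun q => g q - (c * (q.2 - t₀) + l * ‖q.1 - x₀‖ ^ 2)) _ q :=
    (hg.differentiable (by simp) q).hasFDerivAt.sub (hasFDerivAt_mul_norm_sq c l t₀ x₀ q)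
  rw [timeDeriv, h.fderiv]
  simp [timeDeriv]

theorem spaceHessian_sub_mul_norm_sq {g : EuclideanSpace ℝ (Fin n) × ℝ → ℝ}
    (hg : ContDiff ℝ ∞ g) (c l t₀ : ℝ) (x₀ : EuclideanSpace ℝ (Fin n))
    (q : EuclideanSpace ℝ (Fin n) × ℝ) :
    spaceHessian (fun q => g q - (c * (q.2 - t₀) + l * ‖q.1 - x₀‖ ^ 2)) q =
      spaceHessian g q - (2 * l) • (1 : Matrix (Fin n) (Fin n) ℝ) := by
  ext i j
  have h1 : spaceDeriv j (fun q => g q - (c * (q.2 - t₀) + l * ‖q.1 - x₀‖ ^ 2)) =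
      fun q => spaceDeriv j g q - 2 * l * (q.1 j - x₀ j) := by
    funext q
    have h : HasFDerivAt (fun q => g q - (c * (q.2 - t₀) + l * ‖q.1 - x₀‖ ^ 2)) _ q :=
      (hg.differentiable (by simp) q).hasFDerivAt.sub (hasFDerivAt_mul_norm_sq c l t₀ x₀ q)
    rw [spaceDeriv, h.fderiv]
    simp [spaceDeriv, EuclideanSpace.inner_single_right]
    ring
  have h2 : HasFDerivAt (fun q : EuclideanSpace ℝ (Fin n) × ℝ => 2 * l * (q.1 j - x₀ j))
      ((2 * l) • (EuclideanSpace.proj j : EuclideanSpace ℝ (Fin n) →L[ℝ] ℝ).comp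
        (ContinuousLinearMap.fst ℝ (EuclideanSpace ℝ (Fin n)) ℝ)) q :=
    ((((EuclideanSpace.proj (𝕜 := ℝ) j).hasFDerivAt).comp q hasFDerivAt_fst).sub_const
      (x₀ j)).const_mul (2 * l)
  have h3 : HasFDerivAt (fun q => spaceDeriv j g q - 2 * l * (q.1 j - x₀ j)) _ q :=
    ((hg.spaceDeriv j).differentiable (by simp) q).hasFDerivAt.sub h2
  simp only [spaceHessian, Matrix.of_apply, Matrix.sub_apply, Matrix.smul_apply]
  rw [h1, spaceDeriv, h3.fderiv]
  simp [spaceDeriv, Matrix.one_apply, eq_comm]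

/-- Sets on which a smooth approximation satisfies a differential inequality that its limit
violates are asymptotically negligible. -/
theorem tendsto_measure_zero_of_ae_tendsto {α : Type*} [MeasurableSpace α] {μ : Measure α}
    [IsFiniteMeasure μ] {F : ℕ → α → ℝ} {f : α → ℝ} {Γ : ℕ → Set α} {a η : ℝ} (hη : 0 < η)
    (hF : ∀ k, AEStronglyMeasurable (F k) μ)
    (hlim : ∀ᵐ x ∂μ, Tendsto (fun k => F k x) atTop (𝓝 (f x))) (hf : ∀ᵐ x ∂μ, f x ≤ a)
    (hΓ : ∀ k, ∀ x ∈ Γ k, a + η ≤ F k x) :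
    Tendsto (fun k => μ (Γ k)) atTop (𝓝 0) := by
  have h := tendstoInMeasure_iff_dist.1 (tendstoInMeasure_of_tendsto_ae hF hlim) η hη
  refine tendsto_of_tendsto_of_tendsto_of_le_of_le tendsto_const_nhds h (fun k => zero_le)
    fun k => measure_mono_ae ?_
  filter_upwards [hf] with x hx hxΓ
  have := hΓ k x hxΓ
  change η ≤ dist (F k x) (f x)
  rw [Real.dist_eq]
  exact (by linarith : η ≤ F k x - f x).trans (le_abs_self _)

/-- Bony's maximum principle for the operator `∂ₜ - (Δ·)⁺`: let `z` be a Lipschitz function with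
bounded weak space Hessian which satisfies `∂ₜz ≤ (Δz)⁺ + a` almost everywhere. If `z - b (t - t₀)`
has a maximum over the past at `(x₀, t₀)`, then `b ≤ a`. -/
theorem parabolic_maximum_principle {z : EuclideanSpace ℝ (Fin n) × ℝ → ℝ} {K : NNReal}
    {x₀ : EuclideanSpace ℝ (Fin n)} {t₀ r : ℝ} (hr : 0 < r)
    (hz : LipschitzOnWith K z (Metric.ball (x₀, t₀) r))
    {H : EuclideanSpace ℝ (Fin n) × ℝ → Matrix (Fin n) (Fin n) ℝ}
    (hH : IsWeakSpaceHessian (Metric.ball (x₀, t₀) r) z H)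
    (hb : ∀ i j : Fin n, MemLp (fun p => H p i j) ⊤ (volume.restrict (Metric.ball (x₀, t₀) r)))
    {a b : ℝ}
    (heq : ∀ᵐ p ∂volume.restrict (Metric.ball (x₀, t₀) r), ∃ D : ℝ,
      HasDerivAt (fun s => z (p.1, s)) D p.2 ∧ D ≤ max (H p).trace 0 + a)
    (hmax : ∀ p ∈ Metric.ball (x₀, t₀) r, p.2 ≤ t₀ → z p ≤ z (x₀, t₀) + b * (p.2 - t₀)) :
    b ≤ a := by
  by_contra! hab
  set Q := Metric.ball (x₀, t₀) r with hQdef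
  have hQ : IsOpen Q := Metric.isOpen_ball
  have hctr : (x₀, t₀) ∈ Q := Metric.mem_ball_self hr
  obtain ⟨u, hu, hzu⟩ := hz.extend_real
  have hHu : IsWeakSpaceHessian Q u H := fun i j φ h1 h2 h3 => by
    rw [← hH i j φ h1 h2 h3]
    exact setIntegral_congr_fun hQ.measurableSet fun p hp => by simp only [hzu hp]
  obtain ⟨Λ, g, hg, hgu, hgt, hgH, htlim, hHlim⟩ := exists_mollification hu hQ hHu hb
  set μ := (b - a) / 8 with hμ
  set l := (b - a) / (8 * (n + 1)) with hl
  have hμ0 : 0 < μ := by rw [hμ]; linarith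
  have hl0 : 0 < l := div_pos (by linarith) (by positivity)
  have hnl : 2 * l * n ≤ (b - a) / 4 := by
    have : l * (8 * (n + 1)) = b - a := div_mul_cancel₀ _ (by positivity)
    nlinarith
  set ρ := r / 2 with hρ
  have hρ0 : 0 < ρ := half_pos hr
  set θ := min (l * ρ ^ 2) (μ * ρ) with hθ
  have hθ0 : 0 < θ := lt_min (by positivity) (by positivity)
  set G : ℕ → EuclideanSpace ℝ (Fin n) × ℝ → ℝ := fun k q =>
    g k q - ((b - μ) * (q.2 - t₀) + l * ‖q.1 - x₀‖ ^ 2) with hG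
  have hGs : ∀ k, ContDiff ℝ ∞ (G k) := fun k => contDiff_sub_mul_norm_sq (hg k) _ _ _ _
  have hGt : ∀ k q, timeDeriv (G k) q = timeDeriv (g k) q - (b - μ) := fun k q =>
    timeDeriv_sub_mul_norm_sq (hg k) _ _ _ _ q
  have hGH : ∀ k q, spaceHessian (G k) q = spaceHessian (g k) q - (2 * l) • 1 := fun k q =>
    spaceHessian_sub_mul_norm_sq (hg k) _ _ _ _ q
  set cyl := Metric.ball x₀ ρ ×ˢ Ioc (t₀ - ρ) t₀ with hcyl
  have hcylρ : ∀ q ∈ Metric.closedBall x₀ ρ ×ˢ Icc (t₀ - ρ) t₀, dist q (x₀, t₀) ≤ ρ := by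
    rintro ⟨x, t⟩ ⟨hx, ht⟩
    refine max_le hx ?_
    rw [Real.dist_eq, abs_le]
    have h1 : t₀ - ρ ≤ t := ht.1
    have h2 : t ≤ t₀ := ht.2
    constructor <;> simp only <;> linarith
  have hcylQ : Metric.closedBall x₀ ρ ×ˢ Icc (t₀ - ρ) t₀ ⊆ Q := fun q hq =>
    (hcylρ q hq).trans_lt (half_lt_self hr)
  have hcyl' : cyl ⊆ Metric.closedBall x₀ ρ ×ˢ Icc (t₀ - ρ) t₀ :=
    prod_mono Metric.ball_subset_closedBall Ioc_subset_Icc_self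
  set Γ : ℕ → Set (EuclideanSpace ℝ (Fin n) × ℝ) := fun k =>
    {q ∈ cyl | 0 ≤ timeDeriv (G k) q ∧ (spaceHessian (G k) q).trace ≤ 0} with hΓ
  have hε : Tendsto (fun k : ℕ => 1 / ((k : ℝ) + 1)) atTop (𝓝 0) :=
    tendsto_one_div_add_atTop_nhds_zero_nat
  have hKε : Tendsto (fun k : ℕ => K * (1 / ((k : ℝ) + 1))) atTop (𝓝 0) := by
    simpa using hε.const_mul (K : ℝ)
  have hlower : ∀ᶠ k in atTop, volume (Metric.ball (0 : EuclideanSpace ℝ (Fin n))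
      (θ / 2 / (2 * ρ)) ×ˢ Ioo (z (x₀, t₀) - θ / 4 - θ / 2 / 2) (z (x₀, t₀) - θ / 4)) ≤
      ENNReal.ofReal (n.factorial * (Λ + 2 * l) ^ n * (K + |b - μ|)) * volume (Γ k) := by
    filter_upwards [hε.eventually (Iio_mem_nhds hρ0),
      hKε.eventually (Iio_mem_nhds (show 0 < θ / 4 by positivity))] with k hk1 hk2
    change 1 / ((k : ℝ) + 1) < ρ at hk1
    change K * (1 / ((k : ℝ) + 1)) < θ / 4 at hk2
    refine volume_prod_le_of_parabolic_boundary (hGs k) hρ0 ?_ ?_ ?_ ?_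
    · have := (abs_le.1 (hgu k (x₀, t₀))).1
      rw [← hzu hctr] at this
      simp only [hG, sub_self, norm_zero]
      linarith
    · intro x hx t ht hxt
      have hxtQ : (x, t) ∈ Q := hcylQ ⟨hx, ht⟩
      have h1 := (abs_le.1 (hgu k (x, t))).2
      have h2 := hmax (x, t) hxtQ ht.2
      rw [← hzu hxtQ] at h1
      have h3 : μ * (t - t₀) - l * ‖x - x₀‖ ^ 2 ≤ -θ := by
        rcases hxt with h | h
        · rw [← dist_eq_norm, h]
          nlinarith [min_le_left (l * ρ ^ 2) (μ * ρ), ht.2]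
        · rw [h]
          nlinarith [min_le_right (l * ρ ^ 2) (μ * ρ), mul_nonneg hl0.le (sq_nonneg ‖x - x₀‖)]
      simp only at h2
      simp only [hG]
      linarith
    · intro q hq i j
      rw [hGH, Matrix.sub_apply, Matrix.smul_apply, smul_eq_mul]
      have hsub : Metric.closedBall q (1 / ((k : ℝ) + 1)) ⊆ Q := fun y hy => by
        have h1 := hcylρ q (hcyl' hq)
        have h2 : dist y q ≤ _ := hy
        have h3 := dist_triangle y q (x₀, t₀)
        change dist y (x₀, t₀) < r
        linarith
      refine (abs_sub _ _).trans (add_le_add (hgH k q hsub i j) ?_)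
      rw [Matrix.one_apply]
      split_ifs
      · rw [mul_one, abs_of_pos (by positivity)]
      · rw [mul_zero, abs_zero]; positivity
    · intro q hq
      rw [hGt]
      exact (abs_sub _ _).trans (add_le_add (hgt k q) le_rfl)
  have hmeas : Tendsto (fun k => volume (Γ k)) atTop (𝓝 0) := by
    have hfin : IsFiniteMeasure (volume.restrict Q) := ⟨by
      rw [Measure.restrict_apply_univ]; exact measure_ball_lt_top⟩
    have hself : ∀ k, volume.restrict Q (Γ k) = volume (Γ k) := fun k =>
      Measure.restrict_eq_self _ fun q hq => hcylQ (hcyl' hq.1)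
    simp_rw [← hself]
    refine tendsto_measure_zero_of_ae_tendsto
      (F := fun k q => timeDeriv (g k) q - max (spaceHessian (g k) q).trace 0)
      (f := fun q => lineDeriv ℝ u q (0, 1) - max (H q).trace 0) (a := a) (η := (b - a) / 2)
      (by linarith) (fun k => ?_) ?_ ?_ ?_
    · exact ((hg k).timeDeriv.continuous.sub
        ((hg k).continuous_trace_spaceHessian.max continuous_const)).aestronglyMeasurable
    · filter_upwards [ae_restrict_of_ae htlim, hHlim] with q h1 h2
      exact h1.sub (h2.max tendsto_const_nhds)
    · filter_upwards [heq, ae_restrict_mem hQ.measurableSet] with q ⟨D, hD, hDle⟩ hq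
      have hline : HasLineDerivAt ℝ u D q (0, 1) := by
        have h1 : HasDerivAt (fun s => z (q.1, q.2 + s)) D 0 := by
          refine HasDerivAt.comp_const_add q.2 0 (f := fun s => z (q.1, s)) ?_
          simpa using hD
        refine h1.congr_of_eventuallyEq ?_
        have hc : Continuous fun s : ℝ => q + s • ((0, 1) : EuclideanSpace ℝ (Fin n) × ℝ) := by
          fun_prop
        filter_upwards [hc.continuousAt.eventually (hQ.mem_nhds (show q + (0 : ℝ) • _ ∈ Q by
          simpa using hq))] with s hs
        rw [← hzu hs]
        congr 1
        ext1 <;> simp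
      rw [hline.lineDeriv]
      linarith
    · rintro k q ⟨-, h1, h2⟩
      rw [hGt] at h1
      rw [hGH, Matrix.trace_sub, Matrix.trace_smul, Matrix.trace_one, Fintype.card_fin,
        smul_eq_mul] at h2
      have h3 : max (spaceHessian (g k) q).trace 0 ≤ (b - a) / 4 :=
        max_le (by linarith) (by linarith)
      linarith
  have hzero := ENNReal.Tendsto.const_mul (a := ENNReal.ofReal
    (n.factorial * (Λ + 2 * l) ^ n * (K + |b - μ|))) hmeas (Or.inr ENNReal.ofReal_ne_top)
  rw [mul_zero] at hzero
  have hle := ge_of_tendsto hzero hlower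
  refine absurd hle (not_le.2 ?_)
  refine (Metric.isOpen_ball.prod isOpen_Ioo).measure_pos volume ?_
  exact ⟨(0, z (x₀, t₀) - θ / 4 - θ / 8),
    mk_mem_prod (Metric.mem_ball_self (by positivity)) ⟨by linarith, by linarith⟩⟩

end SpaceTime

section Comparison

open Filter
open scoped Topology

variable {n : ℕ}

theorem IsWeakSpaceHessian.mono {Q Q' : Set (EuclideanSpace ℝ (Fin n) × ℝ)}
    {u : EuclideanSpace ℝ (Fin n) × ℝ → ℝ}
    {H : EuclideanSpace ℝ (Fin n) × ℝ → Matrix (Fin n) (Fin n) ℝ} (hH : IsWeakSpaceHessian Q' u H)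
    (hQ' : MeasurableSet Q') (hQ : Q ⊆ Q') : IsWeakSpaceHessian Q u H := by
  intro i j φ hφ hc hs
  have hzero : ∀ f : EuclideanSpace ℝ (Fin n) × ℝ → ℝ, tsupport f ⊆ Q → ∀ q, q ∉ Q → f q = 0 :=
    fun f hf q hq => image_eq_zero_of_notMem_tsupport fun h => hq (hf h)
  have hts : tsupport (spaceDeriv i (spaceDeriv j φ)) ⊆ Q :=
    ((tsupport_fderiv_apply_subset ℝ _).trans (tsupport_fderiv_apply_subset ℝ _)).trans hs
  rw [← setIntegral_eq_of_subset_of_forall_sdiff_eq_zero hQ' hQ fun q hq => by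
      rw [hzero _ hts q hq.2, mul_zero],
    ← setIntegral_eq_of_subset_of_forall_sdiff_eq_zero hQ' hQ fun q hq => by
      rw [hzero _ hs q hq.2, mul_zero]]
  exact hH i j φ hφ hc (hs.trans hQ)

theorem IsWeakSpaceHessian.sub {Q : Set (EuclideanSpace ℝ (Fin n) × ℝ)} (hQ : volume Q ≠ ⊤)
    {u v : EuclideanSpace ℝ (Fin n) × ℝ → ℝ}
    {H G : EuclideanSpace ℝ (Fin n) × ℝ → Matrix (Fin n) (Fin n) ℝ}
    (hu : MemLp u ⊤ (volume.restrict Q)) (hv : MemLp v ⊤ (volume.restrict Q))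
    (hHb : ∀ i j, MemLp (fun p => H p i j) ⊤ (volume.restrict Q))
    (hGb : ∀ i j, MemLp (fun p => G p i j) ⊤ (volume.restrict Q))
    (hH : IsWeakSpaceHessian Q u H) (hG : IsWeakSpaceHessian Q v G) :
    IsWeakSpaceHessian Q (fun p => u p - v p) (fun p => H p - G p) := by
  intro i j φ hφ hc hs
  have hfin : IsFiniteMeasure (volume.restrict Q) := ⟨by
    rw [Measure.restrict_apply_univ]; exact hQ.lt_top⟩
  have hint : ∀ f ψ : EuclideanSpace ℝ (Fin n) × ℝ → ℝ, MemLp f ⊤ (volume.restrict Q) →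
      Continuous ψ → HasCompactSupport ψ → Integrable (fun p => f p * ψ p) (volume.restrict Q) :=
    fun f ψ hf hψ hψc => (hf.integrable le_top).mul_of_top_left
      (hψ.memLp_top_of_hasCompactSupport hψc _)
  have hd := ((hφ.spaceDeriv j).spaceDeriv i).continuous
  have hdc := (hc.spaceDeriv j).spaceDeriv i
  simp only [sub_mul, Matrix.sub_apply]
  rw [integral_sub (hint _ _ hu hd hdc) (hint _ _ hv hd hdc),
    integral_sub (hint _ _ (hHb i j) hφ.continuous hc) (hint _ _ (hGb i j) hφ.continuous hc),
    hH i j φ hφ hc hs, hG i j φ hφ hc hs]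

theorem IsC11PositiveCurvatureFlow.continuousOn {t₁ t₂ : ℝ}
    {E : ℝ → Set (EuclideanSpace ℝ (Fin n))} (hE : IsC11PositiveCurvatureFlow t₁ t₂ E) :
    ContinuousOn (fun p : EuclideanSpace ℝ (Fin n) × ℝ => signedDistToSet (E p.2) p.1)
      (univ ×ˢ Icc t₁ t₂) := by
  obtain ⟨hne, U, hU, hUb, hf, ⟨K, hK⟩, -⟩ := hE
  exact continuousOn_signedDistToSet hne hU hUb hf hK

theorem IsC11PositiveCurvatureFlow.continuousOn_time {t₁ t₂ : ℝ}
    {E : ℝ → Set (EuclideanSpace ℝ (Fin n))} (hE : IsC11PositiveCurvatureFlow t₁ t₂ E)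
    (x : EuclideanSpace ℝ (Fin n)) :
    ContinuousOn (fun t => signedDistToSet (E t) x) (Icc t₁ t₂) :=
  ContinuousOn.comp (g := fun p : EuclideanSpace ℝ (Fin n) × ℝ => signedDistToSet (E p.2) p.1)
    (f := fun t : ℝ => (x, t)) hE.continuousOn (Continuous.prodMk_right x).continuousOn
    fun _ ht => ⟨mem_univ _, ht⟩

theorem LipschitzOnWith.memLp_top_restrict_ball {X : Type*} [PseudoMetricSpace X]
    [SecondCountableTopology X] [MeasurableSpace X] [BorelSpace X] {μ : Measure X} {f : X → ℝ}
    {K : NNReal} {x : X} {r : ℝ} (hf : LipschitzOnWith K f (Metric.ball x r)) :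
    MemLp f ⊤ (μ.restrict (Metric.ball x r)) := by
  refine memLp_top_of_bound
    (hf.continuousOn.aestronglyMeasurable Metric.isOpen_ball.measurableSet) (K * r + ‖f x‖)
    (ae_restrict_of_forall_mem Metric.isOpen_ball.measurableSet fun y hy => ?_)
  have hr : 0 < r := Metric.pos_of_mem_ball hy
  have h1 := hf.dist_le_mul y hy x (Metric.mem_ball_self hr)
  have h2 : dist y x ≤ r := le_of_lt hy
  have h3 := norm_le_norm_add_norm_sub' (f y) (f x)
  rw [← dist_eq_norm] at h3
  have h4 := mul_le_mul_of_nonneg_left h2 K.2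
  change (K : ℝ) * _ ≤ K * r at h4
  linarith

/-- At a positive past maximum of `d₂ - d₁ - c (t - t₀)` lying on `{d₁ ≤ 0 ≤ d₂}`, the slope `c` is
controlled by the error terms in the two equations. -/
theorem slope_le_of_isMax {t₁ t₂ t₀ c a C₁ C₂ : ℝ} {d₁ d₂ : EuclideanSpace ℝ (Fin n) × ℝ → ℝ}
    {U₁ U₂ : Set (EuclideanSpace ℝ (Fin n))} (hU₁ : IsOpen U₁) (hU₂ : IsOpen U₂) {K₁ K₂ : NNReal}
    (hK₁ : LipschitzOnWith K₁ d₁ (U₁ ×ˢ Icc t₁ t₂)) (hK₂ : LipschitzOnWith K₂ d₂ (U₂ ×ˢ Icc t₁ t₂))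
    {H₁ H₂ : EuclideanSpace ℝ (Fin n) × ℝ → Matrix (Fin n) (Fin n) ℝ}
    (hH₁ : IsWeakSpaceHessian (U₁ ×ˢ Ioo t₁ t₂) d₁ H₁)
    (hH₂ : IsWeakSpaceHessian (U₂ ×ˢ Ioo t₁ t₂) d₂ H₂)
    (hb₁ : ∀ i j : Fin n, MemLp (fun p => H₁ p i j) ⊤ (volume.restrict (U₁ ×ˢ Ioo t₁ t₂)))
    (hb₂ : ∀ i j : Fin n, MemLp (fun p => H₂ p i j) ⊤ (volume.restrict (U₂ ×ˢ Ioo t₁ t₂)))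
    (he₁ : ∀ᵐ p ∂(volume.restrict (U₁ ×ˢ Ioo t₁ t₂)),
      ∃ D : ℝ, HasDerivAt (fun s : ℝ => d₁ (p.1, s)) D p.2 ∧
        |D - max (H₁ p).trace 0| ≤ C₁ * |d₁ p|)
    (he₂ : ∀ᵐ p ∂(volume.restrict (U₂ ×ˢ Ioo t₁ t₂)),
      ∃ D : ℝ, HasDerivAt (fun s : ℝ => d₂ (p.1, s)) D p.2 ∧
        |D - max (H₂ p).trace 0| ≤ C₂ * |d₂ p|)
    {x₀ : EuclideanSpace ℝ (Fin n)} {r : ℝ} (hr : 0 < r)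
    (hr₁ : Metric.ball (x₀, t₀) r ⊆ U₁ ×ˢ Ioo t₁ t₂) (hr₂ : Metric.ball (x₀, t₀) r ⊆ U₂ ×ˢ Ioo t₁ t₂)
    (ha : ∀ p ∈ Metric.ball (x₀, t₀) r, C₁ * |d₁ p| + C₂ * |d₂ p| ≤ a)
    (hmax : ∀ p ∈ Metric.ball (x₀, t₀) r, p.2 ≤ t₀ →
      d₂ p - d₁ p ≤ d₂ (x₀, t₀) - d₁ (x₀, t₀) + c * (p.2 - t₀)) :
    c ≤ a := by
  have hm₁ : MeasurableSet (U₁ ×ˢ Ioo t₁ t₂) := (hU₁.prod isOpen_Ioo).measurableSet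
  have hm₂ : MeasurableSet (U₂ ×ˢ Ioo t₁ t₂) := (hU₂.prod isOpen_Ioo).measurableSet
  have hL₁ := hK₁.mono (hr₁.trans (prod_mono_right Ioo_subset_Icc_self))
  have hL₂ := hK₂.mono (hr₂.trans (prod_mono_right Ioo_subset_Icc_self))
  have hB₁ := fun i j => (hb₁ i j).mono_measure (Measure.restrict_mono hr₁ le_rfl)
  have hB₂ := fun i j => (hb₂ i j).mono_measure (Measure.restrict_mono hr₂ le_rfl)
  refine parabolic_maximum_principle (z := fun p => d₂ p - d₁ p) (K := K₂ + K₁)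
    (H := fun p => H₂ p - H₁ p) hr ?_
    ((hH₂.mono hm₂ hr₂).sub measure_ball_lt_top.ne hL₂.memLp_top_restrict_ball
      hL₁.memLp_top_restrict_ball hB₂ hB₁ (hH₁.mono hm₁ hr₁))
    (fun i j => (hB₂ i j).sub (hB₁ i j)) ?_ hmax
  · refine LipschitzOnWith.of_dist_le_mul fun p hp q hq => ?_
    have h1 := hL₁.dist_le_mul p hp q hq
    have h2 := hL₂.dist_le_mul p hp q hq
    have h3 := dist_sub_sub_le (d₂ p) (d₁ p) (d₂ q) (d₁ q)
    push_cast
    linarith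
  · filter_upwards [ae_restrict_of_ae_restrict_of_subset hr₁ he₁,
      ae_restrict_of_ae_restrict_of_subset hr₂ he₂,
      ae_restrict_mem Metric.isOpen_ball.measurableSet] with p ⟨D₁, hD₁, hDe₁⟩ ⟨D₂, hD₂, hDe₂⟩ hp
    refine ⟨D₂ - D₁, hD₂.sub hD₁, ?_⟩
    have h1 := ha p hp
    have h2 := (abs_le.1 hDe₁).1
    have h3 := (abs_le.1 hDe₂).2
    have h4 : max (H₂ p).trace 0 ≤ max (H₂ p - H₁ p).trace 0 + max (H₁ p).trace 0 := by
      rw [Matrix.trace_sub]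
      refine max_le ?_ (add_nonneg (le_max_right _ _) (le_max_right _ _))
      linarith [le_max_left ((H₂ p).trace - (H₁ p).trace) 0, le_max_left (H₁ p).trace 0]
    linarith

theorem IsC11PositiveCurvatureFlow.exists_signedDistToSet_le {t₁ t₂ : ℝ}
    {E₁ E₂ : ℝ → Set (EuclideanSpace ℝ (Fin n))} (h₁ : IsC11PositiveCurvatureFlow t₁ t₂ E₁)
    (h₂ : IsC11PositiveCurvatureFlow t₁ t₂ E₂) {s : ℝ} (hs : s ∈ Ico t₁ t₂)
    (hle : ∀ x, signedDistToSet (E₂ s) x ≤ signedDistToSet (E₁ s) x) :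
    ∃ δ > 0, ∀ t ∈ Icc s (s + δ), ∀ x, signedDistToSet (E₂ t) x ≤ signedDistToSet (E₁ t) x := by
  have hc₁ := h₁.continuousOn
  have hc₂ := h₂.continuousOn
  obtain ⟨hne₁, U₁, hU₁, hUb₁, hf₁, ⟨K₁, hK₁⟩, H₁, hH₁, hb₁, C₁, he₁⟩ := h₁
  obtain ⟨hne₂, U₂, hU₂, hUb₂, hf₂, ⟨K₂, hK₂⟩, H₂, hH₂, hb₂, C₂, he₂⟩ := h₂
  have hsI : s ∈ Icc t₁ t₂ := Ico_subset_Icc_self hs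
  obtain ⟨τ₁, hτ₁, hτU₁⟩ := exists_forall_abs_signedDistToSet_le_mem (hne₁ s hsI).1 (hne₁ s hsI).2
    hU₁ hUb₁ (hf₁ s hsI)
  obtain ⟨τ₂, hτ₂, hτU₂⟩ := exists_forall_abs_signedDistToSet_le_mem (hne₂ s hsI).1 (hne₂ s hsI).2
    hU₂ hUb₂ (hf₂ s hsI)
  set ε := min τ₁ τ₂ / 4 with hε
  have hε0 : 0 < ε := by positivity
  have hετ₁ : 3 * ε ≤ τ₁ := by linarith [min_le_left τ₁ τ₂]
  have hετ₂ : 3 * ε ≤ τ₂ := by linarith [min_le_right τ₁ τ₂]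
  obtain ⟨δ₁, hδ₁, hδε₁⟩ :=
    exists_forall_abs_signedDistToSet_sub_le hne₁ hU₁ hUb₁ hf₁ hK₁ hsI hε0
  obtain ⟨δ₂, hδ₂, hδε₂⟩ :=
    exists_forall_abs_signedDistToSet_sub_le hne₂ hU₂ hUb₂ hf₂ hK₂ hsI hε0
  set C := |C₁| + |C₂| with hC
  have hC0 : 0 ≤ C := by positivity
  obtain ⟨δ, hδ, hδ1, hδ2, hδt, hδC⟩ :
      ∃ δ > 0, δ < δ₁ ∧ δ < δ₂ ∧ s + δ < t₂ ∧ C * δ < 1 / 2 := by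
    have h0 : Tendsto (fun δ : ℝ => δ) (𝓝[>] 0) (𝓝 0) := nhdsWithin_le_nhds
    have h3 : Tendsto (fun δ : ℝ => C * δ) (𝓝[>] 0) (𝓝 0) := by simpa using h0.const_mul C
    have hpos : ∀ᶠ δ : ℝ in 𝓝[>] 0, 0 < δ := self_mem_nhdsWithin
    obtain ⟨δ, e1, e2, e3, e4, e5⟩ := (hpos.and
      ((h0.eventually (Iio_mem_nhds hδ₁)).and ((h0.eventually (Iio_mem_nhds hδ₂)).and
      ((h0.eventually (Iio_mem_nhds (sub_pos.2 hs.2))).and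
        (h3.eventually (Iio_mem_nhds one_half_pos)))))).exists
    exact ⟨δ, e1, e2, e3, by have : δ < t₂ - s := e4; linarith, e5⟩
  have hJ : Icc s (s + δ) ⊆ Icc t₁ t₂ := Icc_subset_Icc hs.1 hδt.le
  refine ⟨δ, hδ, ?_⟩
  by_contra! hcon
  obtain ⟨t, ht, x, hx⟩ := hcon
  set d₁ : EuclideanSpace ℝ (Fin n) × ℝ → ℝ := fun p => signedDistToSet (E₁ p.2) p.1 with hd₁
  set d₂ : EuclideanSpace ℝ (Fin n) × ℝ → ℝ := fun p => signedDistToSet (E₂ p.2) p.1 with hd₂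
  have hretract : ∀ t ∈ Icc s (s + δ), ∀ x, 0 < d₂ (x, t) - d₁ (x, t) →
      ∃ y ∈ U₁ ∩ U₂, d₂ (x, t) - d₁ (x, t) ≤ d₂ (y, t) - d₁ (y, t) ∧
        d₁ (y, t) ≤ 0 ∧ 0 ≤ d₂ (y, t) := by
    intro t ht x hx
    obtain ⟨y, hy, hy1, hy2⟩ := exists_signedDistToSet_nonpos_nonneg (hne₁ t (hJ ht)).1
      (hne₁ t (hJ ht)).2 (hne₂ t (hJ ht)).1 (hne₂ t (hJ ht)).2 hx.le
    have hts : |t - s| ≤ δ := by rw [abs_le]; constructor <;> linarith [ht.1, ht.2]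
    have e1 := abs_le.1 (hδε₁ t (hJ ht) (hts.trans_lt hδ1) y)
    have e2 := abs_le.1 (hδε₂ t (hJ ht) (hts.trans_lt hδ2) y)
    have e3 := hle y
    refine ⟨y, ⟨hτU₁ y ?_, hτU₂ y ?_⟩, hy, hy1, hy2⟩ <;>
    · rw [abs_le]; constructor <;> linarith
  set z : EuclideanSpace ℝ (Fin n) × ℝ → ℝ := fun p => d₂ p - d₁ p with hz
  have hzc : ContinuousOn z (univ ×ˢ Icc t₁ t₂) := hc₂.sub hc₁
  set A := closure U₁ ×ˢ Icc s (s + δ) with hA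
  have hAc : IsCompact A := hUb₁.isCompact_closure.prod isCompact_Icc
  have hAI : A ⊆ univ ×ˢ Icc t₁ t₂ := prod_mono (subset_univ _) hJ
  obtain ⟨y, hyU, hy, -⟩ := hretract t ht x (sub_pos.2 hx)
  have hyA : (y, t) ∈ A := ⟨subset_closure hyU.1, ht⟩
  obtain ⟨⟨xm, tm⟩, hmA, hm⟩ := hAc.exists_isMaxOn ⟨_, hyA⟩ (hzc.mono hAI)
  set m := z (xm, tm) with hmdef
  have hm0 : 0 < m := (sub_pos.2 hx).trans_le (hy.trans (isMaxOn_iff.1 hm _ hyA))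
  set c := m / (2 * δ) with hcdef
  have hc0 : 0 < c := by positivity
  have hcδ : c * δ = m / 2 := by rw [hcdef]; field_simp
  have hfc : ContinuousOn (fun p : EuclideanSpace ℝ (Fin n) × ℝ => z p - c * (p.2 - s)) A :=
    (hzc.mono hAI).sub (by fun_prop)
  obtain ⟨⟨x₀, t₀⟩, h₀A, h₀⟩ := hAc.exists_isMaxOn ⟨_, hyA⟩ hfc
  have h₀m := isMaxOn_iff.1 h₀ _ hmA
  have htm : tm ∈ Icc s (s + δ) := hmA.2
  have ht₀ : t₀ ∈ Icc s (s + δ) := h₀A.2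
  have hfpos : 0 < z (x₀, t₀) - c * (t₀ - s) := by
    have : c * (tm - s) ≤ c * δ := mul_le_mul_of_nonneg_left (by linarith [htm.2]) hc0.le
    simp only at h₀m
    linarith
  have hz₀ : 0 < z (x₀, t₀) := by
    have := mul_nonneg hc0.le (sub_nonneg.2 ht₀.1)
    linarith
  obtain ⟨y₀, hy₀U, hy₀, hy₀1, hy₀2⟩ := hretract t₀ ht₀ x₀ hz₀
  have hy₀A : (y₀, t₀) ∈ A := ⟨subset_closure hy₀U.1, ht₀⟩
  have hzy₀ : z (y₀, t₀) ≤ m := isMaxOn_iff.1 hm _ hy₀A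
  have hst₀ : s < t₀ := by
    refine lt_of_le_of_ne ht₀.1 fun h => ?_
    have h1 := hle x₀
    have h2 : 0 < d₂ (x₀, t₀) - d₁ (x₀, t₀) := hz₀
    rw [← h] at h2
    simp only [hd₁, hd₂] at h2
    linarith
  have hCc : C * m < c := by
    rw [hcdef, lt_div_iff₀ (by positivity)]
    nlinarith
  have hopen : IsOpen ((U₁ ∩ U₂) ×ˢ Ioo s t₂) := (hU₁.inter hU₂).prod isOpen_Ioo
  have hmem : (y₀, t₀) ∈ (U₁ ∩ U₂) ×ˢ Ioo s t₂ := ⟨hy₀U, hst₀, ht₀.2.trans_lt hδt⟩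
  have hsub : (U₁ ∩ U₂) ×ˢ Ioo s t₂ ⊆ univ ×ˢ Icc t₁ t₂ :=
    prod_mono (subset_univ _) (Ioo_subset_Icc_self.trans (Icc_subset_Icc_left hs.1))
  have hec : ContinuousAt (fun p => C₁ * |d₁ p| + C₂ * |d₂ p|) (y₀, t₀) :=
    (((hc₁.abs.const_mul C₁).add (hc₂.abs.const_mul C₂)).mono hsub).continuousAt
      (hopen.mem_nhds hmem)
  have hea : C₁ * |d₁ (y₀, t₀)| + C₂ * |d₂ (y₀, t₀)| < (C * m + c) / 2 := by
    have e1 : |d₁ (y₀, t₀)| + |d₂ (y₀, t₀)| ≤ m := by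
      rw [abs_of_nonpos hy₀1, abs_of_nonneg hy₀2]
      have : d₂ (y₀, t₀) - d₁ (y₀, t₀) ≤ m := hzy₀
      linarith
    have e2 : C₁ * |d₁ (y₀, t₀)| ≤ C * |d₁ (y₀, t₀)| := mul_le_mul_of_nonneg_right
      ((le_abs_self C₁).trans (le_add_of_nonneg_right (abs_nonneg _))) (abs_nonneg _)
    have e3 : C₂ * |d₂ (y₀, t₀)| ≤ C * |d₂ (y₀, t₀)| := mul_le_mul_of_nonneg_right
      ((le_abs_self C₂).trans (le_add_of_nonneg_left (abs_nonneg _))) (abs_nonneg _)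
    nlinarith
  obtain ⟨r, hr, hball⟩ := Metric.mem_nhds_iff.1
    (inter_mem (hopen.mem_nhds hmem) (hec.eventually (Iio_mem_nhds hea)))
  have hIoo : Ioo s t₂ ⊆ Ioo t₁ t₂ := Ioo_subset_Ioo_left hs.1
  have hslope := slope_le_of_isMax (c := c) (a := (C * m + c) / 2) hU₁ hU₂ hK₁ hK₂ hH₁ hH₂ hb₁ hb₂
    he₁ he₂ hr (fun p hp => ⟨(hball hp).1.1.1, hIoo (hball hp).1.2⟩)
    (fun p hp => ⟨(hball hp).1.1.2, hIoo (hball hp).1.2⟩) (fun p hp => le_of_lt (hball hp).2)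
    (fun p hp hpt => by
      have hpA : p ∈ A := ⟨subset_closure (hball hp).1.1.1, (hball hp).1.2.1.le, hpt.trans ht₀.2⟩
      have e1 := isMaxOn_iff.1 h₀ _ hpA
      have e2 : d₂ (x₀, t₀) - d₁ (x₀, t₀) ≤ d₂ (y₀, t₀) - d₁ (y₀, t₀) := hy₀
      simp only [hz] at e1
      linarith)
  linarith

/-- The comparison principle, for the signed distance functions. -/
theorem IsC11PositiveCurvatureFlow.signedDistToSet_le {t₁ t₂ : ℝ}
    {E₁ E₂ : ℝ → Set (EuclideanSpace ℝ (Fin n))} (h₁ : IsC11PositiveCurvatureFlow t₁ t₂ E₁)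
    (h₂ : IsC11PositiveCurvatureFlow t₁ t₂ E₂)
    (hle : ∀ x, signedDistToSet (E₂ t₁) x ≤ signedDistToSet (E₁ t₁) x) :
    ∀ t ∈ Icc t₁ t₂, ∀ x, signedDistToSet (E₂ t) x ≤ signedDistToSet (E₁ t) x := by
  set S := {t | ∀ x, signedDistToSet (E₂ t) x ≤ signedDistToSet (E₁ t) x} with hS
  have hclosed : IsClosed (S ∩ Icc t₁ t₂) := by
    have heq : S ∩ Icc t₁ t₂ =
        ⋂ x, {t ∈ Icc t₁ t₂ | signedDistToSet (E₂ t) x ≤ signedDistToSet (E₁ t) x} := by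
      ext t
      rw [mem_iInter]
      exact ⟨fun h x => ⟨h.2, h.1 x⟩, fun h => ⟨fun x => (h x).2, (h 0).1⟩⟩
    rw [heq]
    exact isClosed_iInter fun x => isClosed_Icc.isClosed_le
      (h₂.continuousOn_time x) (h₁.continuousOn_time x)
  refine hclosed.Icc_subset_of_forall_mem_nhdsWithin hle fun s hs => ?_
  obtain ⟨δ, hδ, h⟩ := h₁.exists_signedDistToSet_le h₂ hs.2 hs.1
  filter_upwards [Ioc_mem_nhdsGT (show s < s + δ by linarith)] with t ht
  exact h t (Ioc_subset_Icc_self ht)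

theorem signedDistToSet_anti {E F : Set (EuclideanSpace ℝ (Fin n))} (hE : E.Nonempty)
    (hF : Fᶜ.Nonempty) (h : E ⊆ F) (x : EuclideanSpace ℝ (Fin n)) :
    signedDistToSet F x ≤ signedDistToSet E x :=
  sub_le_sub (Metric.infDist_le_infDist_of_subset h hE)
    (Metric.infDist_le_infDist_of_subset (compl_subset_compl.2 h) hF)

theorem IsC11PositiveCurvatureFlow.comparison {t₁ t₂ : ℝ}
    {E₁ E₂ : ℝ → Set (EuclideanSpace ℝ (Fin n))} (h₁ : IsC11PositiveCurvatureFlow t₁ t₂ E₁)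
    (h₂ : IsC11PositiveCurvatureFlow t₁ t₂ E₂) (h : E₁ t₁ ⊆ E₂ t₁) {t : ℝ} (ht : t ∈ Icc t₁ t₂) :
    interior (E₁ t) ⊆ interior (E₂ t) ∧ closure (E₁ t) ⊆ closure (E₂ t) ∧
      (IsOpen (E₁ t) ∨ IsClosed (E₂ t) → E₁ t ⊆ E₂ t) := by
  have ht₁ : t₁ ∈ Icc t₁ t₂ := ⟨le_rfl, ht.1.trans ht.2⟩
  have hle := h₁.signedDistToSet_le h₂
    (signedDistToSet_anti (h₁.1 t₁ ht₁).1 (h₂.1 t₁ ht₁).2 h) t ht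
  have hint : interior (E₁ t) ⊆ interior (E₂ t) := fun x hx =>
    (signedDistToSet_neg_iff (h₂.1 t ht).2).1
      ((hle x).trans_lt ((signedDistToSet_neg_iff (h₁.1 t ht).2).2 hx))
  have hcl : closure (E₁ t) ⊆ closure (E₂ t) := fun x hx =>
    (signedDistToSet_nonpos_iff (h₂.1 t ht).1).1
      ((hle x).trans ((signedDistToSet_nonpos_iff (h₁.1 t ht).1).2 hx))
  refine ⟨hint, hcl, ?_⟩
  rintro (ho | hc)
  · exact ho.interior_eq.symm.subset.trans (hint.trans interior_subset)
  · exact subset_closure.trans (hcl.trans hc.closure_eq.subset)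

end Comparison

theorem mainTheorem8 (n : ℕ) (t₁ t₂ : ℝ) :
    (∀ E₁ E₂ : ℝ → Set (EuclideanSpace ℝ (Fin n)),
      IsC11PositiveCurvatureFlow t₁ t₂ E₁ → IsC11PositiveCurvatureFlow t₁ t₂ E₂ →
      E₁ t₁ ⊆ E₂ t₁ →
      ∀ t ∈ Icc t₁ t₂,
        interior (E₁ t) ⊆ interior (E₂ t) ∧ closure (E₁ t) ⊆ closure (E₂ t) ∧
        (IsOpen (E₁ t) ∨ IsClosed (E₂ t) → E₁ t ⊆ E₂ t)) ∧
    (∀ E : Set (EuclideanSpace ℝ (Fin n)),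
      ∀ E₁ E₂ : ℝ → Set (EuclideanSpace ℝ (Fin n)),
      IsC11PositiveCurvatureFlow t₁ t₂ E₁ → IsC11PositiveCurvatureFlow t₁ t₂ E₂ →
      E₁ t₁ = E → E₂ t₁ = E →
      ∀ t ∈ Icc t₁ t₂,
        interior (E₁ t) = interior (E₂ t) ∧ closure (E₁ t) = closure (E₂ t) ∧
        ((IsOpen (E₁ t) ∧ IsOpen (E₂ t)) ∨ (IsClosed (E₁ t) ∧ IsClosed (E₂ t)) →
          E₁ t = E₂ t)) := by
  refine ⟨fun E₁ E₂ h₁ h₂ h t ht => h₁.comparison h₂ h ht, ?_⟩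
  intro E E₁ E₂ h₁ h₂ e₁ e₂ t ht
  obtain ⟨a1, a2, a3⟩ := h₁.comparison h₂ (e₁.trans e₂.symm).subset ht
  obtain ⟨b1, b2, b3⟩ := h₂.comparison h₁ (e₂.trans e₁.symm).subset ht
  refine ⟨a1.antisymm b1, a2.antisymm b2, ?_⟩
  rintro (⟨o1, o2⟩ | ⟨c1, c2⟩)
  · exact (a3 (Or.inl o1)).antisymm (b3 (Or.inl o2))
  · exact (a3 (Or.inr c2)).antisymm (b3 (Or.inr c1))
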